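/- Let $\mu$ be the standard Gaussian measure on $\mathbb{R}^n$, and let $E_1,\dots,E_m$ be linear subspaces of $\mathbb{R}^n$ and $c_1,\dots,c_m>0$ real numbers such that $$\mathrm{Id}_{\mathbb{R}^n}=\sum_{i=1}^m c_i\,Q_{E_i},$$ where $Q_{E_i}$ denotes the orthogonal projection of $\mathbb{R}^n$ onto $E_i$. Then for every smooth (that is, $C^\infty$) function $f:\mathbb{R}^n\to\mathbb{R}$, $$\mathrm{Var}_\mu(f)\le 4\sum_{i=1}^m c_i\,\frac{\|Q_{E_i}(\nabla f)\|_2^2}{1+\log\big(\|Q_{E_i}(\nabla f)\|_2/\|Q_{E_i}(\nabla f)\|_1\big)},$$ where $\|g\|_p=\big(\int_{\mathbb{R}^n}|g|^p\,d\mu\big)^{1/p}$ for a vector field $g$ on $\mathbb{R}^n$, with $|\cdot|$ the Euclidean norm. Both sides take values in $[0,\infty]$: the variance is $+\infty$ if $f\notin L^2(\mu)$, and the $i$-th term of the sum is $0$ if $Q_{E_i}(\nabla f)=0$ $\mu$-almost everywhere and $+\infty$ if $\|Q_{E_i}(\nabla f)\|_2=\infty$. In particular, if all $\|Q_{E_i}(\nabla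 f)\|_2$ are finite, then $f\in L^2(\mu)$. -/

import Mathlib

open MeasureTheory ProbabilityTheory
open scoped ENNReal ContDiff Gradient

/-- The quantity `‖g‖₂² / (1 + log (‖g‖₂ / ‖g‖₁))`, with the `L^p(μ)`-norms of the Euclidean length
of a vector field `g`, for a probability measure `μ`. It is `∞` when `‖g‖₂ = ∞`, and it is `0`
when `g = 0` almost everywhere; otherwise `0 < ‖g‖₁ ≤ ‖g‖₂ < ∞` and the formula is read
literally. -/
noncomputable def talagrandTerm {X F : Type*} [MeasurableSpace X] [NormedAddCommGroup F]
    (μ : Measure X) (g : X → F) : ℝ≥0∞ :=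
  open scoped Classical in
  if eLpNorm g 2 μ = ⊤ then ⊤
  else ENNReal.ofReal
    ((eLpNorm g 2 μ).toReal ^ 2 /
      (1 + Real.log ((eLpNorm g 2 μ).toReal / (eLpNorm g 1 μ).toReal)))

/-!
The variance is written through correlated Gaussian vectors. For independent standard Gaussian
vectors `X`, `Z`, the function `Φ θ = E[f(X) f(cos θ X + sin θ Z)]` satisfies
`Φ 0 - Φ (π / 2) = Var f`. Rotation invariance of the law of `(X, Z)` and Gaussian integration by
parts give
`-Φ' θ = sin θ * E⟪∇f(X), ∇f(Y)⟫` with `Y = cos θ X - sin θ Z` (`hasDerivAt_integral_correlated`).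
The decomposition of the identity splits the inner product into `∑ c_i ⟪Q_i ∇f(X), Q_i ∇f(Y)⟫`, and
Gaussian hypercontractivity bounds each expectation by the square of the `L^{1 + cos θ}` norm of
`Q_i ∇f` (`lintegral_mul_le_of_correlated`). Hölder interpolation between the `L¹` and `L²` norms
turns this bound into an explicit exponential in `1 - cos θ`, whose antiderivative in `θ` produces
the factor `1 / (1 + log (‖Q_i ∇f‖₂ / ‖Q_i ∇f‖₁))`, with the constant `exp 1 ≤ 4`.

Hypercontractivity is proved in the bilinear form
`E[u(A) v(B)] ≤ ‖u(A)‖_p ‖v(B)‖_p`, `p = 1 + ρ`. It holds for two `ρ`-correlated signs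
(`two_point_ennreal`), it is stable under convolution of the joint law (`IsHypercontractive.conv`),
and it passes to correlated Gaussian vectors in the limit by Lévy's convergence theorem
(`exists_tendsto_gaussianPairLaw`).

These steps need `f` and its gradient to be bounded. A general `f` is approximated by compactly
supported functions whose gradients are, up to a small uniform error, contractions of the gradient
of `f`, so that the right-hand side does not grow. Fatou's lemma for the double integral of
`|f(x) - f(y)| ^ 2` then yields both `f ∈ L²` and the inequality
(`evariance_le_of_eLpNorm_gradient_ne_top`).
-/

open Filter Topology
open scoped NNReal RealInnerProductSpace

/-! ### Two-point hypercontractivity and convolution -/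

/-- The second-order lower bound for `E|1 + ε b| ^ p`: the second derivative in `b` is at least
`p * (p - 1)`, by the arithmetic-geometric mean inequality for `(1 ± b) ^ (p - 2)`. -/
lemma two_point_normalized {p b : ℝ} (hp1 : 1 ≤ p) (hp2 : p ≤ 2) (hb0 : 0 ≤ b) (hb1 : b ≤ 1) :
    1 + p * (p - 1) / 2 * b ^ 2 ≤ ((1 + b) ^ p + (1 - b) ^ p) / 2 := by
  have hmono : MonotoneOn (fun x : ℝ ↦ (1 + x) ^ (p - 1) - (1 - x) ^ (p - 1) - 2 * (p - 1) * x)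
      (Set.Icc 0 1) := by
    have hd : ∀ x ∈ Set.Ioo (0 : ℝ) 1,
        HasDerivAt (fun x : ℝ ↦ (1 + x) ^ (p - 1) - (1 - x) ^ (p - 1) - 2 * (p - 1) * x)
          (1 * (p - 1) * (1 + x) ^ (p - 1 - 1) - (-1) * (p - 1) * (1 - x) ^ (p - 1 - 1)
            - 2 * (p - 1) * 1) x := by
      intro x hx
      refine HasDerivAt.sub (HasDerivAt.sub ?_ ?_) ((hasDerivAt_id x).const_mul _)
      · exact ((hasDerivAt_id x).const_add 1).rpow_const (Or.inl (by simp; linarith [hx.1]))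
      · exact ((hasDerivAt_id x).const_sub 1).rpow_const (Or.inl (by simp; linarith [hx.2]))
    refine monotoneOn_of_deriv_nonneg (convex_Icc 0 1) ?_ ?_ ?_
    · refine ContinuousOn.sub (ContinuousOn.sub ?_ ?_) (by fun_prop)
      · exact ContinuousOn.rpow_const (by fun_prop) fun x _ ↦ Or.inr (by linarith)
      · exact ContinuousOn.rpow_const (by fun_prop) fun x _ ↦ Or.inr (by linarith)
    · rw [interior_Icc]
      exact fun x hx ↦ (hd x hx).differentiableAt.differentiableWithinAt
    · rw [interior_Icc]
      intro x hx
      rw [(hd x hx).deriv]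
      have hx1 : 0 < 1 + x := by linarith [hx.1]
      have hx2 : 0 < 1 - x := by linarith [hx.2]
      -- the two powers have product `(1 - x ^ 2) ^ (p - 2) ≥ 1`, hence sum at least `2`
      have hprod : 1 ≤ (1 + x) ^ (p - 1 - 1) * (1 - x) ^ (p - 1 - 1) := by
        rw [← Real.mul_rpow hx1.le hx2.le]
        exact Real.one_le_rpow_of_pos_of_le_one_of_nonpos (by positivity)
          (by nlinarith [hx.1]) (by linarith)
      have h1 := Real.rpow_pos_of_pos hx1 (p - 1 - 1)
      have h2 := Real.rpow_pos_of_pos hx2 (p - 1 - 1)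
      have key : 2 ≤ (1 + x) ^ (p - 1 - 1) + (1 - x) ^ (p - 1 - 1) := by
        nlinarith [sq_nonneg ((1 + x) ^ (p - 1 - 1) - (1 - x) ^ (p - 1 - 1))]
      nlinarith
  have hmono2 : MonotoneOn (fun x : ℝ ↦ (1 + x) ^ p + (1 - x) ^ p - p * (p - 1) * x ^ 2)
      (Set.Icc 0 1) := by
    have hd : ∀ x : ℝ, HasDerivAt (fun x : ℝ ↦ (1 + x) ^ p + (1 - x) ^ p - p * (p - 1) * x ^ 2)
          (1 * p * (1 + x) ^ (p - 1) + (-1) * p * (1 - x) ^ (p - 1)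
            - p * (p - 1) * (2 * x)) x := by
      intro x
      refine HasDerivAt.sub (HasDerivAt.add ?_ ?_) ?_
      · exact ((hasDerivAt_id x).const_add 1).rpow_const (Or.inr hp1)
      · exact ((hasDerivAt_id x).const_sub 1).rpow_const (Or.inr hp1)
      · simpa using (hasDerivAt_pow 2 x).const_mul (p * (p - 1))
    refine monotoneOn_of_deriv_nonneg (convex_Icc 0 1) ?_ ?_ ?_
    · exact fun x _ ↦ (hd x).continuousAt.continuousWithinAt
    · exact fun x _ ↦ (hd x).differentiableAt.differentiableWithinAt
    · rw [interior_Icc]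
      intro x hx
      rw [(hd x).deriv]
      have := hmono (Set.left_mem_Icc.2 zero_le_one) (Set.Ioo_subset_Icc_self hx) hx.1.le
      simp only [add_zero, sub_zero, Real.one_rpow, mul_zero, sub_self] at this
      nlinarith
  have := hmono2 (Set.left_mem_Icc.2 zero_le_one) ⟨hb0, hb1⟩ hb0
  simp only [add_zero, sub_zero, Real.one_rpow, mul_zero, ne_eq, OfNat.ofNat_ne_zero,
    not_false_eq_true, zero_pow] at this
  linarith

/-- **Bonami's two-point inequality** with exponents `p` and `2`. -/
lemma two_point_sq_le {ρ x y : ℝ} (hρ0 : 0 ≤ ρ) (hρ1 : ρ ≤ 1) (hx : 0 ≤ x) (hy : 0 ≤ y) :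
    ((x + y) / 2) ^ 2 + ρ * ((x - y) / 2) ^ 2 ≤
      (((x ^ (1 + ρ) + y ^ (1 + ρ)) / 2) ^ (1 / (1 + ρ))) ^ 2 := by
  wlog hxy : y ≤ x generalizing x y
  · have := this hy hx (not_le.1 hxy).le
    rw [add_comm y x, add_comm (y ^ _)] at this
    linarith [show ((y - x) / 2) ^ 2 = ((x - y) / 2) ^ 2 by ring]
  rcases hx.eq_or_lt with rfl | hx
  · obtain rfl : y = 0 := le_antisymm hxy hy
    have : (0 : ℝ) < 1 + ρ := by linarith
    simp [Real.zero_rpow this.ne', sq_nonneg]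
  set p := 1 + ρ with hp
  have hp0 : 0 < p := by linarith
  set a := (x + y) / 2 with ha
  have ha0 : 0 < a := by positivity
  set t := (x - y) / (x + y) with ht
  have hxy0 : 0 < x + y := by positivity
  have ht0 : 0 ≤ t := div_nonneg (by linarith) hxy0.le
  have ht1 : t ≤ 1 := (div_le_one hxy0).2 (by linarith)
  have ex : x = a * (1 + t) := by rw [ha, ht]; field_simp; ring
  have ey : y = a * (1 - t) := by rw [ha, ht]; field_simp; ring
  have e1 : ((x - y) / 2) = a * t := by rw [ex, ey]; ring
  have e2 : (x ^ p + y ^ p) / 2 = a ^ p * (((1 + t) ^ p + (1 - t) ^ p) / 2) := by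
    rw [ex, ey, Real.mul_rpow ha0.le (by linarith), Real.mul_rpow ha0.le (by linarith)]
    ring
  have h1 := two_point_normalized (p := p) (by linarith) (by linarith) ht0 ht1
  have h2 : (1 + ρ * t ^ 2) ^ (p / 2) ≤ ((1 + t) ^ p + (1 - t) ^ p) / 2 := by
    refine le_trans (rpow_one_add_le_one_add_mul_self (by nlinarith [sq_nonneg t])
      (by linarith) (by linarith)) (le_trans (le_of_eq ?_) h1)
    rw [hp]; ring
  have h3 : 0 ≤ 1 + ρ * t ^ 2 := by positivity
  rw [e1, e2, Real.mul_rpow (by positivity) ((Real.rpow_nonneg h3 _).trans h2),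
    ← Real.rpow_mul ha0.le, mul_one_div_cancel hp0.ne', Real.rpow_one, mul_pow, mul_pow]
  have h4 : 1 + ρ * t ^ 2 ≤ ((((1 + t) ^ p + (1 - t) ^ p) / 2) ^ (1 / p)) ^ 2 := by
    calc 1 + ρ * t ^ 2 = (((1 + ρ * t ^ 2) ^ (p / 2)) ^ (1 / p)) ^ 2 := by
          have : p / 2 * (1 / p) * ((2 : ℕ) : ℝ) = 1 := by field_simp; norm_num
          rw [← Real.rpow_mul h3, ← Real.rpow_mul_natCast h3, this, Real.rpow_one]
      _ ≤ _ := by gcongr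
  nlinarith [mul_le_mul_of_nonneg_left h4 (sq_nonneg a)]

/-- The two-point hypercontractive inequality for two `ρ`-correlated signs, in real form. -/
lemma two_point_bilinear {ρ x y x' y' : ℝ} (hρ0 : 0 ≤ ρ) (hρ1 : ρ ≤ 1)
    (hx : 0 ≤ x) (hy : 0 ≤ y) (hx' : 0 ≤ x') (hy' : 0 ≤ y') :
    (1 + ρ) / 4 * (x * x' + y * y') + (1 - ρ) / 4 * (x * y' + y * x') ≤
      ((x ^ (1 + ρ) + y ^ (1 + ρ)) / 2) ^ (1 / (1 + ρ)) *
        ((x' ^ (1 + ρ) + y' ^ (1 + ρ)) / 2) ^ (1 / (1 + ρ)) := by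
  have h1 := two_point_sq_le hρ0 hρ1 hx hy
  have h2 := two_point_sq_le hρ0 hρ1 hx' hy'
  set A := ((x ^ (1 + ρ) + y ^ (1 + ρ)) / 2) ^ (1 / (1 + ρ))
  set B := ((x' ^ (1 + ρ) + y' ^ (1 + ρ)) / 2) ^ (1 / (1 + ρ))
  have hA : 0 ≤ A := by positivity
  have hB : 0 ≤ B := by positivity
  refine abs_le_of_sq_le_sq' ?_ (by positivity) |>.2
  have e : (1 + ρ) / 4 * (x * x' + y * y') + (1 - ρ) / 4 * (x * y' + y * x') =
    (x + y) / 2 * ((x' + y') / 2) + ρ * ((x - y) / 2 * ((x' - y') / 2)) := by ring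
  rw [e, mul_pow]
  refine le_trans ?_ (mul_le_mul h1 h2 (by positivity) (by positivity))
  nlinarith [mul_nonneg hρ0 (sq_nonneg ((x + y) / 2 * ((x' - y') / 2)
    - (x - y) / 2 * ((x' + y') / 2)))]

/-- The joint law of two `ρ`-correlated uniform signs. -/
noncomputable def signLaw (ρ : ℝ) : Measure (ℝ × ℝ) :=
  ENNReal.ofReal ((1 + ρ) / 4) • (Measure.dirac (1, 1) + Measure.dirac (-1, -1)) +
    ENNReal.ofReal ((1 - ρ) / 4) • (Measure.dirac (1, -1) + Measure.dirac (-1, 1))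

lemma lintegral_signLaw (ρ : ℝ) {F : ℝ × ℝ → ℝ≥0∞} (hF : Measurable F) :
    ∫⁻ s, F s ∂(signLaw ρ) =
      ENNReal.ofReal ((1 + ρ) / 4) * (F (1, 1) + F (-1, -1)) +
        ENNReal.ofReal ((1 - ρ) / 4) * (F (1, -1) + F (-1, 1)) := by
  simp [signLaw, lintegral_add_measure, lintegral_smul_measure, lintegral_dirac' _ hF, mul_add]

lemma isProbabilityMeasure_signLaw {ρ : ℝ} (hρ0 : 0 ≤ ρ) (hρ1 : ρ ≤ 1) :
    IsProbabilityMeasure (signLaw ρ) := by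
  constructor
  rw [← lintegral_one, lintegral_signLaw ρ measurable_const, one_add_one_eq_two,
    ← add_mul, ← ENNReal.ofReal_add (by linarith) (by linarith),
    show (2 : ℝ≥0∞) = ENNReal.ofReal 2 by simp, ← ENNReal.ofReal_mul (by linarith)]
  ring_nf
  simp

/-- The two-point inequality for `[0, ∞]`-valued functions, as needed for iterating it under
`lintegral`. -/
lemma two_point_ennreal {ρ : ℝ} (hρ0 : 0 ≤ ρ) (hρ1 : ρ ≤ 1) (x y x' y' : ℝ≥0∞) :
    ENNReal.ofReal ((1 + ρ) / 4) * (x * x' + y * y') +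
        ENNReal.ofReal ((1 - ρ) / 4) * (x * y' + y * x') ≤
      ((x ^ (1 + ρ) + y ^ (1 + ρ)) / 2) ^ (1 / (1 + ρ)) *
        ((x' ^ (1 + ρ) + y' ^ (1 + ρ)) / 2) ^ (1 / (1 + ρ)) := by
  have hp : 0 < 1 + ρ := by linarith
  have hp' : 0 < 1 / (1 + ρ) := by positivity
  -- an infinite value makes one factor infinite, unless the other function vanishes
  have key : ∀ x y x' y' : ℝ≥0∞, x = ⊤ ∨ y = ⊤ →
      ENNReal.ofReal ((1 + ρ) / 4) * (x * x' + y * y') +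
        ENNReal.ofReal ((1 - ρ) / 4) * (x * y' + y * x') ≤
      ((x ^ (1 + ρ) + y ^ (1 + ρ)) / 2) ^ (1 / (1 + ρ)) *
        ((x' ^ (1 + ρ) + y' ^ (1 + ρ)) / 2) ^ (1 / (1 + ρ)) := by
    intro x y x' y' h
    have h1 : ((x ^ (1 + ρ) + y ^ (1 + ρ)) / 2) ^ (1 / (1 + ρ)) = ⊤ := by
      rcases h with rfl | rfl <;>
      simp [ENNReal.top_rpow_of_pos hp, ENNReal.top_div, ENNReal.top_rpow_of_pos (inv_pos.2 hp)]
    rw [h1]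
    by_cases h0 : x' = 0 ∧ y' = 0
    · simp [h0.1, h0.2]
    · have : ((x' ^ (1 + ρ) + y' ^ (1 + ρ)) / 2) ^ (1 / (1 + ρ)) ≠ 0 := by
        simp only [ne_eq, ENNReal.rpow_eq_zero_iff, ENNReal.div_eq_zero_iff, add_eq_zero, hp, hp',
          hp.not_gt, hp'.not_gt]
        simpa using h0
      rw [ENNReal.top_mul this]
      exact le_top
  by_cases hxy : x = ⊤ ∨ y = ⊤
  · exact key x y x' y' hxy
  by_cases hxy' : x' = ⊤ ∨ y' = ⊤
  · have := key x' y' x y hxy'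
    refine le_trans (le_of_eq ?_) (this.trans_eq (mul_comm _ _))
    ring
  push Not at hxy hxy'
  lift x to ℝ≥0 using hxy.1
  lift y to ℝ≥0 using hxy.2
  lift x' to ℝ≥0 using hxy'.1
  lift y' to ℝ≥0 using hxy'.2
  have h := ENNReal.ofReal_le_ofReal (two_point_bilinear hρ0 hρ1 x.coe_nonneg y.coe_nonneg
    x'.coe_nonneg y'.coe_nonneg)
  have hρ2 : 0 ≤ 1 - ρ := by linarith
  have e : ∀ a b : ℝ≥0, ENNReal.ofReal ((((a : ℝ) ^ (1 + ρ) + (b : ℝ) ^ (1 + ρ)) / 2) ^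
      (1 / (1 + ρ))) = (((a : ℝ≥0∞) ^ (1 + ρ) + (b : ℝ≥0∞) ^ (1 + ρ)) / 2) ^ (1 / (1 + ρ)) := by
    intro a b
    rw [← ENNReal.ofReal_rpow_of_nonneg (by positivity) hp'.le,
      ENNReal.ofReal_div_of_pos two_pos, ENNReal.ofReal_add (by positivity) (by positivity),
      ← ENNReal.ofReal_rpow_of_nonneg a.coe_nonneg hp.le,
      ← ENNReal.ofReal_rpow_of_nonneg b.coe_nonneg hp.le]
    simp
  have e' : ∀ a b c d : ℝ≥0, ENNReal.ofReal ((a : ℝ) * b + c * d) =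
      (a : ℝ≥0∞) * b + c * d := by
    intro a b c d
    rw [ENNReal.ofReal_add (by positivity) (by positivity), ENNReal.ofReal_mul a.coe_nonneg,
      ENNReal.ofReal_mul c.coe_nonneg]
    simp
  rwa [ENNReal.ofReal_mul (by positivity), e, e, ENNReal.ofReal_add (by positivity)
    (by positivity), ENNReal.ofReal_mul (by positivity), ENNReal.ofReal_mul (by positivity),
    e', e'] at h

/-- A law `π` of a pair `(A, B)` is hypercontractive with exponent `p` if
`E[u(A) v(B)] ≤ ‖u(A)‖_p ‖v(B)‖_p` for all nonnegative functions `u` and `v`. -/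
def IsHypercontractive {H W : Type*} [MeasurableSpace H] [MeasurableSpace W] (p : ℝ) (A B : H → W)
    (π : Measure H) : Prop :=
  ∀ u v : W → ℝ≥0∞, Measurable u → Measurable v →
    ∫⁻ z, u (A z) * v (B z) ∂π ≤
      (∫⁻ z, u (A z) ^ p ∂π) ^ (1 / p) * (∫⁻ z, v (B z) ^ p ∂π) ^ (1 / p)

/-- Sums of independent hypercontractive pairs are hypercontractive. -/
lemma IsHypercontractive.conv {H W : Type*} [MeasurableSpace H] [MeasurableSpace W]
    [AddMonoid H] [Add W] [MeasurableAdd₂ H] [MeasurableAdd₂ W] {p : ℝ} (hp : 0 < p)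
    {A B : H → W} (hA : Measurable A) (hB : Measurable B)
    (hA' : ∀ x y, A (x + y) = A x + A y) (hB' : ∀ x y, B (x + y) = B x + B y)
    {π π' : Measure H} [SFinite π] [SFinite π'] (h : IsHypercontractive p A B π)
    (h' : IsHypercontractive p A B π') : IsHypercontractive p A B (π ∗ π') := by
  intro u v hu hv
  have hp1 : 1 / p * p = 1 := one_div_mul_cancel hp.ne'
  rw [Measure.lintegral_conv (by fun_prop), Measure.lintegral_conv (by fun_prop),
    Measure.lintegral_conv (by fun_prop)]
  simp only [hA', hB']
  -- apply `h'` with the first summand frozen, then `h` to the resulting partial norms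
  have h1 : ∀ x, ∫⁻ y, u (A x + A y) * v (B x + B y) ∂π' ≤
      (∫⁻ y, u (A x + A y) ^ p ∂π') ^ (1 / p) * (∫⁻ y, v (B x + B y) ^ p ∂π') ^ (1 / p) :=
    fun x ↦ h' (fun w ↦ u (A x + w)) (fun w ↦ v (B x + w)) (by fun_prop) (by fun_prop)
  have hm : ∀ (u : W → ℝ≥0∞) (A : H → W), Measurable u → Measurable A →
      Measurable fun w ↦ (∫⁻ y, u (w + A y) ^ p ∂π') ^ (1 / p) := fun u A hu hA ↦
    (Measurable.lintegral_prod_right' (f := fun q : W × H ↦ u (q.1 + A q.2) ^ p)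
      (by fun_prop)).pow_const _
  refine (lintegral_mono h1).trans ((h _ _ (hm u A hu hA) (hm v B hv hB)).trans (le_of_eq ?_))
  simp_rw [← ENNReal.rpow_mul, hp1, ENNReal.rpow_one]

/-- Finite convolutions of hypercontractive laws, recorded through their characteristic functions,
which is all that the passage to the limit uses. -/
lemma IsHypercontractive.exists_finset_conv {H W : Type*} [MeasurableSpace W]
    [NormedAddCommGroup H] [InnerProductSpace ℝ H] [FiniteDimensional ℝ H] [MeasurableSpace H]
    [BorelSpace H]
    [Add W] [MeasurableAdd₂ W] {p : ℝ} (hp : 0 < p)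
    {A B : H → W} (hA : Measurable A) (hB : Measurable B)
    (hA' : ∀ x y, A (x + y) = A x + A y) (hB' : ∀ x y, B (x + y) = B x + B y) {ι : Type*}
    (π : ι → Measure H) [∀ i, IsProbabilityMeasure (π i)]
    (h : ∀ i, IsHypercontractive p A B (π i)) (s : Finset ι) :
    ∃ ν : Measure H, IsProbabilityMeasure ν ∧ IsHypercontractive p A B ν ∧
      ∀ t, charFun ν t = ∏ i ∈ s, charFun (π i) t := by
  classical
  induction s using Finset.induction_on with
  | empty =>
    refine ⟨Measure.dirac 0, inferInstance, ?_, fun t ↦ by simp⟩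
    intro u v hu hv
    rw [lintegral_dirac' _ (by fun_prop), lintegral_dirac' _ (by fun_prop),
      lintegral_dirac' _ (by fun_prop), ← ENNReal.rpow_mul, ← ENNReal.rpow_mul,
      mul_one_div_cancel hp.ne', ENNReal.rpow_one, ENNReal.rpow_one]
  | insert i s hi ih =>
    obtain ⟨ν, hν, hνh, hνc⟩ := ih
    refine ⟨π i ∗ ν, inferInstance, (h i).conv hp hA hB hA' hB' hνh, fun t ↦ ?_⟩
    rw [charFun_conv, hνc, Finset.prod_insert hi]

/-! ### Gaussian hypercontractivity from the central limit theorem -/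

section CentralLimit

variable {W : Type*} [NormedAddCommGroup W] [InnerProductSpace ℝ W]
  [MeasurableSpace W] [BorelSpace W]

/-- The joint law of `(ε e, ε' e)` for `ρ`-correlated uniform signs `ε, ε'` and a vector `e`, on the
Hilbert space `W × W`. -/
noncomputable def signPairLaw (ρ : ℝ) (e : W) : Measure (WithLp 2 (W × W)) :=
  (signLaw ρ).map fun s ↦ WithLp.toLp 2 (s.1 • e, s.2 • e)

lemma measurable_signPair (e : W) :
    Measurable fun s : ℝ × ℝ ↦ WithLp.toLp 2 (s.1 • e, s.2 • e) := by
  fun_prop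

lemma isProbabilityMeasure_signPairLaw {ρ : ℝ} (hρ0 : 0 ≤ ρ) (hρ1 : ρ ≤ 1) (e : W) :
    IsProbabilityMeasure (signPairLaw ρ e) :=
  have := isProbabilityMeasure_signLaw hρ0 hρ1
  Measure.isProbabilityMeasure_map (measurable_signPair e).aemeasurable

variable [FiniteDimensional ℝ W]

lemma isHypercontractive_signPairLaw {ρ : ℝ} (hρ0 : 0 ≤ ρ) (hρ1 : ρ ≤ 1) (e : W) :
    IsHypercontractive (1 + ρ) (WithLp.fst (p := 2) (α := W) (β := W))
      (WithLp.snd (p := 2) (α := W) (β := W)) (signPairLaw ρ e) := by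
  intro u v hu hv
  have hA : Measurable (WithLp.fst (p := 2) (α := W) (β := W)) := by fun_prop
  have hB : Measurable (WithLp.snd (p := 2) (α := W) (β := W)) := by fun_prop
  have hS := measurable_signPair e
  -- both marginals are uniform on `{e, -e}`
  have hmarg : ∀ a b : ℝ≥0∞, ENNReal.ofReal ((1 + ρ) / 4) * (a + b) +
      ENNReal.ofReal ((1 - ρ) / 4) * (a + b) = (a + b) / 2 := by
    intro a b
    rw [← add_mul, ← ENNReal.ofReal_add (by linarith) (by linarith), mul_comm,
      ENNReal.div_eq_inv_mul, mul_comm]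
    congr 1
    rw [show (1 + ρ) / 4 + (1 - ρ) / 4 = 2⁻¹ by ring, ENNReal.ofReal_inv_of_pos two_pos]
    simp
  rw [signPairLaw, lintegral_map (by fun_prop) hS, lintegral_map (by fun_prop) hS,
    lintegral_map (by fun_prop) hS, lintegral_signLaw _ (by fun_prop),
    lintegral_signLaw _ (by fun_prop), lintegral_signLaw _ (by fun_prop)]
  simp only [one_smul, WithLp.fst, WithLp.snd]
  rw [hmarg, add_comm (v ((-1 : ℝ) • e) ^ (1 + ρ)) (v e ^ (1 + ρ)), hmarg]
  exact two_point_ennreal hρ0 hρ1 _ _ _ _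

lemma charFun_signPairLaw {ρ : ℝ} (hρ0 : 0 ≤ ρ) (hρ1 : ρ ≤ 1) (e : W) (t : WithLp 2 (W × W)) :
    charFun (signPairLaw ρ e) t =
      (((1 + ρ) / 2 * Real.cos (⟪e, t.fst⟫ + ⟪e, t.snd⟫) +
        (1 - ρ) / 2 * Real.cos (⟪e, t.fst⟫ - ⟪e, t.snd⟫) : ℝ) : ℂ) := by
  have hi : ∀ (F : ℝ × ℝ → ℂ) (x : ℝ × ℝ), Integrable F (Measure.dirac x) := fun F x ↦
    integrable_dirac (by simp)
  rw [charFun_apply, signPairLaw, integral_map (measurable_signPair e).aemeasurable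
    (Measurable.aestronglyMeasurable (by fun_prop)), signLaw,
    integral_add_measure (((hi _ _).add_measure (hi _ _)).smul_measure ENNReal.ofReal_ne_top)
      (((hi _ _).add_measure (hi _ _)).smul_measure ENNReal.ofReal_ne_top),
    integral_smul_measure, integral_smul_measure, integral_add_measure (hi _ _) (hi _ _),
    integral_add_measure (hi _ _) (hi _ _)]
  simp only [integral_dirac, WithLp.prod_inner_apply, ENNReal.toReal_ofReal
    (show (0 : ℝ) ≤ (1 + ρ) / 4 by linarith), ENNReal.toReal_ofReal
    (show (0 : ℝ) ≤ (1 - ρ) / 4 by linarith)]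
  simp only [real_inner_smul_left, one_mul, neg_mul, Complex.real_smul]
  push_cast
  rw [Complex.cos, Complex.cos]
  simp only [WithLp.fst, WithLp.snd]
  ring_nf

lemma tendsto_mul_cos_div_sqrt_sub_one (x : ℝ) :
    Tendsto (fun N : ℕ ↦ (N : ℝ) * (Real.cos (x / √N) - 1)) atTop (𝓝 (-(x ^ 2 / 2))) := by
  have h0 : Tendsto (fun N : ℕ ↦ x / √N / 2) atTop (𝓝 0) := by
    have : Tendsto (fun N : ℕ ↦ √(N : ℝ)) atTop atTop :=
      Real.tendsto_sqrt_atTop.comp tendsto_natCast_atTop_atTop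
    simpa using (this.const_div_atTop x).div_const 2
  have h1 : Tendsto (fun N : ℕ ↦ -(x ^ 2 / 2) * Real.sinc (x / √N / 2) ^ 2) atTop
      (𝓝 (-(x ^ 2 / 2) * Real.sinc 0 ^ 2)) :=
    (((Real.continuous_sinc.tendsto 0).comp h0).pow 2).const_mul _
  rw [Real.sinc_zero, one_pow, mul_one] at h1
  refine h1.congr' ?_
  filter_upwards [eventually_gt_atTop 0] with N hN
  have hN' : (0 : ℝ) < N := by exact_mod_cast hN
  have hs : √(N : ℝ) ^ 2 = N := Real.sq_sqrt hN'.le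
  have hs0 : 0 < √(N : ℝ) := Real.sqrt_pos.2 hN'
  have h2 : Real.cos (x / √N) = 1 - 2 * Real.sin (x / √N / 2) ^ 2 := by
    have := Real.cos_two_mul (x / √N / 2)
    rw [mul_div_cancel₀ _ two_ne_zero] at this
    rw [this, Real.sin_sq]; ring
  have h3 : Real.sin (x / √N / 2) = x / √N / 2 * Real.sinc (x / √N / 2) := by
    rcases eq_or_ne (x / √N / 2) 0 with h | h
    · simp [h]
    · rw [Real.sinc_of_ne_zero h, mul_div_cancel₀ _ h]
  rw [h2, h3]
  calc -(x ^ 2 / 2) * Real.sinc (x / √N / 2) ^ 2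
      = √(N : ℝ) ^ 2 * (1 - 2 * (x / √N / 2 * Real.sinc (x / √N / 2)) ^ 2 - 1) := by
        generalize Real.sinc (x / √N / 2) = y
        field_simp
        ring
    _ = _ := by rw [hs]

/-- The central limit theorem for the pairs `(ε e, ε' e)`, at the level of characteristic
functions. -/
lemma tendsto_charFun_signPairLaw_pow {ρ : ℝ} (hρ0 : 0 ≤ ρ) (hρ1 : ρ ≤ 1) (e : W)
    (t : WithLp 2 (W × W)) :
    Tendsto (fun N : ℕ ↦ charFun (signPairLaw ρ ((√(N : ℝ))⁻¹ • e)) t ^ N) atTop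
      (𝓝 (Complex.exp ((-((⟪e, t.fst⟫ ^ 2 + ⟪e, t.snd⟫ ^ 2
        + 2 * ρ * (⟪e, t.fst⟫ * ⟪e, t.snd⟫)) / 2) : ℝ) : ℂ))) := by
  set a := ⟪e, t.fst⟫ with ha
  set b := ⟪e, t.snd⟫ with hb
  set g : ℕ → ℝ := fun N ↦ (1 + ρ) / 2 * (Real.cos ((a + b) / √N) - 1) +
    (1 - ρ) / 2 * (Real.cos ((a - b) / √N) - 1) with hg
  have h1 : ∀ N : ℕ, charFun (signPairLaw ρ ((√(N : ℝ))⁻¹ • e)) t = 1 + ((g N : ℝ) : ℂ) := by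
    intro N
    rw [charFun_signPairLaw hρ0 hρ1, real_inner_smul_left, real_inner_smul_left, ← ha, ← hb, hg]
    norm_cast
    rw [show (√(N : ℝ))⁻¹ * a + (√(N : ℝ))⁻¹ * b = (a + b) / √N by ring,
      show (√(N : ℝ))⁻¹ * a - (√(N : ℝ))⁻¹ * b = (a - b) / √N by ring]
    ring
  simp_rw [h1]
  refine Complex.tendsto_one_add_pow_exp_of_tendsto ?_
  have h2 : Tendsto (fun N : ℕ ↦ (N : ℝ) * g N) atTop
      (𝓝 (-((a ^ 2 + b ^ 2 + 2 * ρ * (a * b)) / 2))) := by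
    have := ((tendsto_mul_cos_div_sqrt_sub_one (a + b)).const_mul ((1 + ρ) / 2)).add
      ((tendsto_mul_cos_div_sqrt_sub_one (a - b)).const_mul ((1 - ρ) / 2))
    convert this using 2
    · simp only [hg]; ring
    · ring
  have h3 := (Complex.continuous_ofReal.tendsto _).comp h2
  refine h3.congr fun N ↦ ?_
  simp

variable (W) in
/-- The law of the pair `(X, cos θ X + sin θ Z)`, for independent standard Gaussian vectors `X`
and `Z`. -/
noncomputable def gaussianPairLaw (θ : ℝ) : Measure (WithLp 2 (W × W)) :=
  ((stdGaussian W).prod (stdGaussian W)).map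
    fun z ↦ WithLp.toLp 2 (z.1, Real.cos θ • z.1 + Real.sin θ • z.2)

lemma measurable_gaussianPair (θ : ℝ) :
    Measurable fun z : W × W ↦ WithLp.toLp 2 (z.1, Real.cos θ • z.1 + Real.sin θ • z.2) := by
  fun_prop

instance isProbabilityMeasure_gaussianPairLaw (θ : ℝ) :
    IsProbabilityMeasure (gaussianPairLaw W θ) :=
  Measure.isProbabilityMeasure_map (measurable_gaussianPair θ).aemeasurable

lemma charFun_gaussianPairLaw (θ : ℝ) (t : WithLp 2 (W × W)) :
    charFun (gaussianPairLaw W θ) t = Complex.exp ((-((‖t.fst‖ ^ 2 + ‖t.snd‖ ^ 2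
        + 2 * Real.cos θ * ⟪t.fst, t.snd⟫) / 2) : ℝ) : ℂ) := by
  rw [charFun_apply, gaussianPairLaw, integral_map (measurable_gaussianPair θ).aemeasurable
    (Measurable.aestronglyMeasurable (by fun_prop))]
  have h : ∀ z : W × W, Complex.exp
      (⟪WithLp.toLp 2 (z.1, Real.cos θ • z.1 + Real.sin θ • z.2), t⟫ * Complex.I) =
      Complex.exp (⟪z.1, t.fst + Real.cos θ • t.snd⟫ * Complex.I) *
        Complex.exp (⟪z.2, Real.sin θ • t.snd⟫ * Complex.I) := by
    intro z
    rw [← Complex.exp_add, ← add_mul, ← Complex.ofReal_add]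
    congr 3
    simp only [WithLp.prod_inner_apply, inner_add_left, inner_add_right, real_inner_smul_left,
      real_inner_smul_right, WithLp.fst, WithLp.snd]
    ring
  simp_rw [h]
  rw [integral_prod_mul (fun x : W ↦ Complex.exp (⟪x, t.fst + Real.cos θ • t.snd⟫ * Complex.I))
    (fun y : W ↦ Complex.exp (⟪y, Real.sin θ • t.snd⟫ * Complex.I)), ← charFun_apply,
    ← charFun_apply, charFun_stdGaussian, charFun_stdGaussian, ← Complex.exp_add]
  norm_cast
  rw [norm_add_sq_real, norm_smul, norm_smul, real_inner_smul_right]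
  congr 1
  simp only [mul_pow, Real.norm_eq_abs, sq_abs]
  rw [Real.sin_sq]
  ring

/-- Hypercontractive signs converge to correlated Gaussian vectors by the central limit theorem. -/
lemma exists_tendsto_gaussianPairLaw {θ : ℝ} (hθ : 0 ≤ Real.cos θ) :
    ∃ ν : ℕ → ProbabilityMeasure (WithLp 2 (W × W)),
      (∀ N, IsHypercontractive (1 + Real.cos θ) (WithLp.fst (p := 2) (α := W) (β := W))
        (WithLp.snd (p := 2) (α := W) (β := W)) (ν N : Measure (WithLp 2 (W × W)))) ∧
      Tendsto ν atTop
        (𝓝 (⟨gaussianPairLaw W θ, inferInstance⟩ : ProbabilityMeasure (WithLp 2 (W × W)))) := by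
  set b := stdOrthonormalBasis ℝ W
  have hprob : ∀ e : W, IsProbabilityMeasure (signPairLaw (Real.cos θ) e) :=
    fun e ↦ isProbabilityMeasure_signPairLaw hθ (Real.cos_le_one θ) e
  have h : ∀ N : ℕ, ∃ ν : Measure (WithLp 2 (W × W)), IsProbabilityMeasure ν ∧
      IsHypercontractive (1 + Real.cos θ) (WithLp.fst (p := 2) (α := W) (β := W))
        (WithLp.snd (p := 2) (α := W) (β := W)) ν ∧
      ∀ t, charFun ν t =
        ∏ i, charFun (signPairLaw (Real.cos θ) ((√(N : ℝ))⁻¹ • b i)) t ^ N := by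
    intro N
    obtain ⟨ν, h1, h2, h3⟩ := IsHypercontractive.exists_finset_conv (p := 1 + Real.cos θ)
      (by linarith) (A := WithLp.fst (p := 2) (α := W) (β := W))
      (B := WithLp.snd (p := 2) (α := W) (β := W)) (by fun_prop) (by fun_prop)
      (fun _ _ ↦ rfl) (fun _ _ ↦ rfl)
      (fun i : Fin (Module.finrank ℝ W) × Fin N ↦
        signPairLaw (Real.cos θ) ((√(N : ℝ))⁻¹ • b i.1))
      (fun i ↦ isHypercontractive_signPairLaw hθ (Real.cos_le_one θ) _) Finset.univ
    refine ⟨ν, h1, h2, fun t ↦ ?_⟩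
    rw [h3, Fintype.prod_prod_type]
    simp
  choose ν h1 h2 h3 using h
  refine ⟨fun N ↦ ⟨ν N, h1 N⟩, h2, ProbabilityMeasure.tendsto_of_tendsto_charFun fun t ↦ ?_⟩
  simp only [ProbabilityMeasure.coe_mk, h3, charFun_gaussianPairLaw]
  have := tendsto_finsetProd Finset.univ fun i (_ : i ∈ Finset.univ) ↦
    tendsto_charFun_signPairLaw_pow hθ (Real.cos_le_one θ) (b i) t
  convert this using 2
  rw [← Complex.exp_sum, ← Complex.ofReal_sum, Finset.sum_neg_distrib, ← Finset.sum_div,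
    Finset.sum_add_distrib, Finset.sum_add_distrib, ← Finset.mul_sum, b.sum_sq_inner_right,
    b.sum_sq_inner_right]
  congr 6
  rw [← b.sum_inner_mul_inner]
  exact Finset.sum_congr rfl fun i _ ↦ by rw [real_inner_comm]

lemma map_rotation_fst_stdGaussian (θ : ℝ) :
    ((stdGaussian W).prod (stdGaussian W)).map
      (fun z ↦ Real.cos θ • z.1 + Real.sin θ • z.2) = stdGaussian W := by
  have h := IsGaussian.map_rotation_eq_self (μ := stdGaussian W) (by simp) θ
  have h2 := congrArg (Measure.map Prod.fst) h
  rw [Measure.map_map (by fun_prop) (by fun_prop), Measure.map_fst_prod, measure_univ, one_smul]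
    at h2
  exact h2
/-- **Gaussian hypercontractivity**, in the form of an estimate for correlated Gaussian vectors. -/
lemma lintegral_mul_le_of_correlated {θ : ℝ} (hθ : 0 ≤ Real.cos θ) {h : W → ℝ≥0}
    (hcont : Continuous h) {M : ℝ≥0} (hM : ∀ x, h x ≤ M) :
    ∫⁻ z, (h z.1 : ℝ≥0∞) * h (Real.cos θ • z.1 + Real.sin θ • z.2)
        ∂((stdGaussian W).prod (stdGaussian W)) ≤
      (∫⁻ x, (h x : ℝ≥0∞) ^ (1 + Real.cos θ) ∂(stdGaussian W)) ^ (2 / (1 + Real.cos θ)) := by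
  set p := 1 + Real.cos θ with hp
  have hp0 : 0 < p := by linarith
  obtain ⟨ν, hν, hlim⟩ := exists_tendsto_gaussianPairLaw (W := W) hθ
  replace hlim := ProbabilityMeasure.tendsto_iff_forall_lintegral_tendsto.1 hlim
  have hlimit : ∀ F : WithLp 2 (W × W) → ℝ≥0, Continuous F → ∀ C : ℝ≥0, (∀ z, F z ≤ C) →
      Tendsto (fun N ↦ ∫⁻ z, (F z : ℝ≥0∞) ∂(ν N : Measure (WithLp 2 (W × W)))) atTop
        (𝓝 (∫⁻ z : W × W, (F (WithLp.toLp 2 (z.1, Real.cos θ • z.1 + Real.sin θ • z.2)) : ℝ≥0∞)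
          ∂((stdGaussian W).prod (stdGaussian W)))) := by
    intro F hF C hC
    have := hlim (BoundedContinuousFunction.mkOfBound ⟨F, hF⟩ C fun x y ↦ by
      rw [NNReal.dist_eq]
      exact abs_sub_le_of_nonneg_of_le (F x).2 (hC x) (F y).2 (hC y))
    rw [ProbabilityMeasure.coe_mk, gaussianPairLaw, lintegral_map (by fun_prop)
      (measurable_gaussianPair θ)] at this
    exact this
  have hfst : Continuous (WithLp.fst (p := 2) (α := W) (β := W)) := by fun_prop
  have hsnd : Continuous (WithLp.snd (p := 2) (α := W) (β := W)) := by fun_prop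
  have hpow : Continuous fun x : ℝ≥0 ↦ x ^ p := NNReal.continuous_rpow_const hp0.le
  have hpM : ∀ x, h x ^ p ≤ M ^ p := fun x ↦ NNReal.rpow_le_rpow (hM x) hp0.le
  have hcoe : ∀ x : W, (h x : ℝ≥0∞) ^ p = ((h x ^ p : ℝ≥0) : ℝ≥0∞) := fun x ↦
    (ENNReal.coe_rpow_of_nonneg _ hp0.le).symm
  have hfin : ∀ g : W × W → W, (∫⁻ z, ((h (g z) ^ p : ℝ≥0) : ℝ≥0∞)
      ∂((stdGaussian W).prod (stdGaussian W))) ^ (1 / p) ≠ ⊤ := by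
    intro g
    refine ENNReal.rpow_ne_top_of_nonneg (by positivity) (ne_of_lt ?_)
    calc _ ≤ ∫⁻ z, ((M ^ p : ℝ≥0) : ℝ≥0∞) ∂((stdGaussian W).prod (stdGaussian W)) :=
          lintegral_mono fun z ↦ ENNReal.coe_le_coe.2 (hpM _)
      _ < ⊤ := by simp
  have h1 := hlimit (fun z ↦ h z.fst * h z.snd) (by fun_prop) (M * M)
    fun z ↦ mul_le_mul' (hM _) (hM _)
  have h2 := hlimit (fun z ↦ h z.fst ^ p) (hpow.comp (hcont.comp hfst)) (M ^ p) fun z ↦ hpM _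
  have h3 := hlimit (fun z ↦ h z.snd ^ p) (hpow.comp (hcont.comp hsnd)) (M ^ p) fun z ↦ hpM _
  have h4 := ENNReal.Tendsto.mul ((ENNReal.continuous_rpow_const (y := 1 / p)).tendsto _ |>.comp h2)
    (Or.inr (hfin _)) ((ENNReal.continuous_rpow_const (y := 1 / p)).tendsto _ |>.comp h3)
    (Or.inr (hfin _))
  have h5 := le_of_tendsto_of_tendsto' h1 h4 fun N ↦ by
    have := hν N (fun x ↦ h x) (fun x ↦ h x) (by fun_prop) (by fun_prop)
    simp only [← hp, hcoe] at this
    simpa only [ENNReal.coe_mul, Function.comp_apply] using this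
  simp only [ENNReal.coe_mul] at h5
  refine h5.trans (le_of_eq ?_)
  -- both marginals of the pair are the standard Gaussian
  have e1 : ∫⁻ z : W × W, ((h z.1 ^ p : ℝ≥0) : ℝ≥0∞) ∂((stdGaussian W).prod (stdGaussian W)) =
      ∫⁻ x, (h x : ℝ≥0∞) ^ p ∂(stdGaussian W) := by
    simp only [hcoe]
    rw [← lintegral_map (f := fun x ↦ ((h x ^ p : ℝ≥0) : ℝ≥0∞)) (by fun_prop) measurable_fst,
      Measure.map_fst_prod, measure_univ, one_smul]
  have e2 : ∫⁻ z : W × W, ((h (Real.cos θ • z.1 + Real.sin θ • z.2) ^ p : ℝ≥0) : ℝ≥0∞)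
      ∂((stdGaussian W).prod (stdGaussian W)) = ∫⁻ x, (h x : ℝ≥0∞) ^ p ∂(stdGaussian W) := by
    simp only [hcoe]
    conv_rhs => rw [← map_rotation_fst_stdGaussian (W := W) θ]
    rw [lintegral_map (by fun_prop) (by fun_prop)]
  simp only [WithLp.fst, WithLp.snd]
  rw [e1, e2, ← ENNReal.rpow_add_of_nonneg _ _ (by positivity) (by positivity)]
  congr 1
  ring

end CentralLimit

/-! ### Gaussian integration by parts and the derivative along correlated pairs -/

section Stein

variable {W : Type*} [NormedAddCommGroup W] [InnerProductSpace ℝ W] [FiniteDimensional ℝ W]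
  [MeasurableSpace W] [BorelSpace W]

lemma hasDerivAt_gaussianPDFReal (x : ℝ) :
    HasDerivAt (gaussianPDFReal 0 1) (-(x * gaussianPDFReal 0 1 x)) x := by
  rw [gaussianPDFReal_def]
  have h1 : HasDerivAt (fun x : ℝ ↦ -(x - 0) ^ 2 / (2 * ((1 : ℝ≥0) : ℝ))) (-x) x := by
    simp only [sub_zero]
    refine (((hasDerivAt_pow 2 x).neg).div_const (2 * ((1 : ℝ≥0) : ℝ))).congr_deriv ?_
    push_cast
    ring
  refine ((h1.exp).const_mul (√(2 * Real.pi * ((1 : ℝ≥0) : ℝ)))⁻¹).congr_deriv ?_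
  ring

lemma integrable_id_mul_gaussianPDFReal :
    Integrable fun x : ℝ ↦ x * gaussianPDFReal 0 1 x := by
  have := (integrable_mul_exp_neg_mul_sq (b := 1 / 2) (by norm_num)).const_mul
    (√(2 * Real.pi * ((1 : ℝ≥0) : ℝ)))⁻¹
  refine this.congr (Eventually.of_forall fun x ↦ ?_)
  simp only [gaussianPDFReal_def]
  rw [show -(x - 0) ^ 2 / (2 * ((1 : ℝ≥0) : ℝ)) = -(1 / 2) * x ^ 2 by push_cast; ring]
  ring

/-- **Stein's identity** for the standard Gaussian measure on the line. -/
lemma integral_mul_id_gaussianReal {φ φ' : ℝ → ℝ} (hφ : ∀ x, HasDerivAt φ (φ' x) x)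
    (hφ' : Measurable φ') {M M' : ℝ} (hM : ∀ x, |φ x| ≤ M) (hM' : ∀ x, |φ' x| ≤ M') :
    ∫ x, φ x * x ∂(gaussianReal 0 1) = ∫ x, φ' x ∂(gaussianReal 0 1) := by
  have hφm : AEStronglyMeasurable φ volume :=
    (continuous_iff_continuousAt.2 fun x ↦ (hφ x).continuousAt).aestronglyMeasurable
  have h1 : Integrable fun x ↦ φ x * (-(x * gaussianPDFReal 0 1 x)) :=
    integrable_id_mul_gaussianPDFReal.neg.bdd_mul hφm (Eventually.of_forall hM)
  have h2 : Integrable fun x ↦ φ' x * gaussianPDFReal 0 1 x :=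
    (integrable_gaussianPDFReal 0 1).bdd_mul hφ'.aestronglyMeasurable (Eventually.of_forall hM')
  have h3 : Integrable fun x ↦ φ x * gaussianPDFReal 0 1 x :=
    (integrable_gaussianPDFReal 0 1).bdd_mul hφm (Eventually.of_forall hM)
  have h := integral_mul_deriv_eq_deriv_mul_of_integrable (fun x _ ↦ hφ x)
    (fun x _ ↦ hasDerivAt_gaussianPDFReal x) h1 h2 h3
  rw [integral_gaussianReal_eq_integral_smul one_ne_zero,
    integral_gaussianReal_eq_integral_smul one_ne_zero]
  calc ∫ x, gaussianPDFReal 0 1 x • (φ x * x)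
      = -∫ x, φ x * (-(x * gaussianPDFReal 0 1 x)) := by
        rw [← integral_neg]
        refine integral_congr_ae (Eventually.of_forall fun x ↦ ?_)
        simp only [smul_eq_mul]; ring
    _ = ∫ x, gaussianPDFReal 0 1 x • φ' x := by
        rw [h, neg_neg]
        refine integral_congr_ae (Eventually.of_forall fun x ↦ ?_)
        simp only [smul_eq_mul]; ring

/-- Resampling the coordinate along a unit vector `e` by an independent standard Gaussian variable
does not change the law of a standard Gaussian vector. -/
lemma map_resample_stdGaussian {e : W} (he : ‖e‖ = 1) :
    ((stdGaussian W).prod (gaussianReal 0 1)).map (fun z ↦ (z.1 + (z.2 - ⟪e, z.1⟫) • e, z.2)) =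
      (stdGaussian W).map fun x ↦ (x, ⟪e, x⟫) := by
  have m1 : Measurable fun z : W × ℝ ↦ (z.1 + (z.2 - ⟪e, z.1⟫) • e, z.2) := by fun_prop
  have m2 : Measurable fun x : W ↦ (x, ⟪e, x⟫) := by fun_prop
  have := Measure.isProbabilityMeasure_map m1.aemeasurable
    (μ := (stdGaussian W).prod (gaussianReal 0 1))
  have := Measure.isProbabilityMeasure_map m2.aemeasurable (μ := stdGaussian W)
  refine (MeasurableEquiv.toLp 2 (W × ℝ)).map_measurableEquiv_injective
    (Measure.ext_of_charFun (funext fun t ↦ ?_))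
  have ht : Measurable (WithLp.toLp 2 : W × ℝ → WithLp 2 (W × ℝ)) := by fun_prop
  rw [MeasurableEquiv.coe_toLp, Measure.map_map ht m1, Measure.map_map ht m2, charFun_apply,
    charFun_apply, integral_map (ht.comp m1).aemeasurable (Measurable.aestronglyMeasurable
    (by fun_prop)), integral_map (ht.comp m2).aemeasurable (Measurable.aestronglyMeasurable
    (by fun_prop))]
  have h1 : ∀ z : W × ℝ, Complex.exp
      (⟪(WithLp.toLp 2 ∘ fun z : W × ℝ ↦ (z.1 + (z.2 - ⟪e, z.1⟫) • e, z.2)) z, t⟫ * Complex.I) =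
      Complex.exp (⟪z.1, t.fst - ⟪e, t.fst⟫ • e⟫ * Complex.I) *
        Complex.exp (⟪z.2, ⟪e, t.fst⟫ + t.snd⟫ * Complex.I) := by
    intro z
    rw [← Complex.exp_add, ← add_mul, ← Complex.ofReal_add]
    congr 3
    simp only [Function.comp_apply, WithLp.prod_inner_apply, inner_add_left, inner_add_right,
      inner_sub_right, real_inner_smul_left, real_inner_smul_right, WithLp.fst, WithLp.snd]
    rw [real_inner_comm e z.1]
    simp only [RCLike.inner_apply, conj_trivial]
    ring
  have h2 : ∀ x : W, Complex.exp
      (⟪(WithLp.toLp 2 ∘ fun x : W ↦ (x, ⟪e, x⟫)) x, t⟫ * Complex.I) =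
      Complex.exp (⟪x, t.fst + t.snd • e⟫ * Complex.I) := by
    intro x
    congr 3
    simp only [Function.comp_apply, WithLp.prod_inner_apply, inner_add_right,
      real_inner_smul_right, WithLp.fst, WithLp.snd]
    rw [real_inner_comm e x]
    simp only [RCLike.inner_apply, conj_trivial]
  simp_rw [h1, h2]
  rw [integral_prod_mul (fun x : W ↦ Complex.exp (⟪x, t.fst - ⟪e, t.fst⟫ • e⟫ * Complex.I))
    (fun y : ℝ ↦ Complex.exp (⟪y, ⟪e, t.fst⟫ + t.snd⟫ * Complex.I)), ← charFun_apply,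
    ← charFun_apply, ← charFun_apply, charFun_stdGaussian, charFun_stdGaussian,
    charFun_gaussianReal, ← Complex.exp_add]
  congr 1
  have e1 : ‖t.fst - ⟪e, t.fst⟫ • e‖ ^ 2 = ‖t.fst‖ ^ 2 - ⟪e, t.fst⟫ ^ 2 := by
    rw [norm_sub_sq_real, norm_smul, real_inner_smul_right, real_inner_comm, he]
    simp only [mul_pow, Real.norm_eq_abs, sq_abs]
    ring
  have e2 : ‖t.fst + t.snd • e‖ ^ 2 = ‖t.fst‖ ^ 2 + 2 * t.snd * ⟪e, t.fst⟫ + t.snd ^ 2 := by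
    rw [norm_add_sq_real, norm_smul, real_inner_smul_right, real_inner_comm, he]
    simp only [mul_pow, Real.norm_eq_abs, sq_abs]
    ring
  simp only [← Complex.ofReal_pow]
  rw [e1, e2]
  push_cast
  ring

/-- **Gaussian integration by parts** along a unit vector. -/
lemma integral_mul_inner_stdGaussian_of_norm_eq_one {φ : W → ℝ} (hφ : ContDiff ℝ 1 φ) {M M' : ℝ}
    (hM : ∀ x, |φ x| ≤ M) (hM' : ∀ x, ‖fderiv ℝ φ x‖ ≤ M') {e : W} (he : ‖e‖ = 1) :
    ∫ x, φ x * ⟪e, x⟫ ∂(stdGaussian W) = ∫ x, fderiv ℝ φ x e ∂(stdGaussian W) := by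
  have m1 : Measurable fun z : W × ℝ ↦ (z.1 + (z.2 - ⟪e, z.1⟫) • e, z.2) := by fun_prop
  have m2 : Measurable fun x : W ↦ (x, ⟪e, x⟫) := by fun_prop
  have hc : Continuous φ := hφ.continuous
  have hc' : Continuous fun x ↦ fderiv ℝ φ x e :=
    (hφ.continuous_fderiv one_ne_zero).clm_apply continuous_const
  have hb' : ∀ x, |fderiv ℝ φ x e| ≤ M' := fun x ↦ by
    simpa [he] using (ContinuousLinearMap.le_opNorm _ _).trans
      (mul_le_mul_of_nonneg_right (hM' x) (norm_nonneg e))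
  have key : ∀ F : W × ℝ → ℝ, Measurable F → ∫ x, F (x, ⟪e, x⟫) ∂(stdGaussian W) =
      ∫ z, F (z.1 + (z.2 - ⟪e, z.1⟫) • e, z.2) ∂((stdGaussian W).prod (gaussianReal 0 1)) := by
    intro F hF
    rw [← integral_map m2.aemeasurable hF.aestronglyMeasurable, ← map_resample_stdGaussian he,
      integral_map m1.aemeasurable hF.aestronglyMeasurable]
  rw [key (fun q ↦ φ q.1 * q.2) (by fun_prop), key (fun q ↦ fderiv ℝ φ q.1 e) (by fun_prop),
    integral_prod, integral_prod]
  · refine integral_congr_ae (Eventually.of_forall fun x ↦ ?_)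
    refine integral_mul_id_gaussianReal (φ := fun g ↦ φ (x + (g - ⟪e, x⟫) • e)) (M := M) (M' := M')
      (fun g ↦ ?_) (by fun_prop) (fun _ ↦ hM _) (fun _ ↦ hb' _)
    have h1 : HasDerivAt (fun g : ℝ ↦ x + (g - ⟪e, x⟫) • e) ((1 : ℝ) • e) g :=
      (((hasDerivAt_id g).sub_const _).smul_const e).const_add x
    rw [one_smul] at h1
    exact ((hφ.differentiable one_ne_zero _).hasFDerivAt).comp_hasDerivAt g h1
  · exact (integrable_const M').mono' (by fun_prop) (Eventually.of_forall fun _ ↦ hb' _)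
  · exact (IsGaussian.integrable_id.comp_snd (stdGaussian W)).bdd_mul (by fun_prop)
      (Eventually.of_forall fun _ ↦ hM _)

/-- **Gaussian integration by parts**. -/
lemma integral_mul_inner_stdGaussian {φ : W → ℝ} (hφ : ContDiff ℝ 1 φ) {M M' : ℝ}
    (hM : ∀ x, |φ x| ≤ M) (hM' : ∀ x, ‖fderiv ℝ φ x‖ ≤ M') (w : W) :
    ∫ x, φ x * ⟪w, x⟫ ∂(stdGaussian W) = ∫ x, fderiv ℝ φ x w ∂(stdGaussian W) := by
  rcases eq_or_ne w 0 with rfl | hw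
  · simp
  have hw' : ‖w‖ ≠ 0 := norm_ne_zero_iff.2 hw
  have h := integral_mul_inner_stdGaussian_of_norm_eq_one hφ hM hM' (e := ‖w‖⁻¹ • w)
    (by rw [norm_smul, norm_inv, norm_norm, inv_mul_cancel₀ hw'])
  simp only [real_inner_smul_left, map_smul, smul_eq_mul, mul_left_comm _ ‖w‖⁻¹,
    integral_const_mul] at h
  exact mul_left_cancel₀ (inv_ne_zero hw') h

/-- The derivative of `E[f(X) f(cos θ X + sin θ Z)]` in `θ`: the vectors `cos θ X + sin θ Z` and
`-sin θ X + cos θ Z` are again independent standard Gaussian, and integration by parts in the second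
one gives a correlation of gradients. -/
lemma hasDerivAt_integral_correlated {f : W → ℝ} (hf : ContDiff ℝ 1 f) {M M' : ℝ}
    (hM : ∀ x, |f x| ≤ M) (hM' : ∀ x, ‖fderiv ℝ f x‖ ≤ M') (θ : ℝ) :
    HasDerivAt (fun θ ↦ ∫ z, f z.1 * f (Real.cos θ • z.1 + Real.sin θ • z.2)
        ∂((stdGaussian W).prod (stdGaussian W)))
      (-(Real.sin θ * ∫ z, ⟪∇ f z.1, ∇ f (Real.cos (-θ) • z.1 + Real.sin (-θ) • z.2)⟫
        ∂((stdGaussian W).prod (stdGaussian W)))) θ := by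
  set γ := stdGaussian W
  have hc : Continuous f := hf.continuous
  have hfd : Continuous (fderiv ℝ f) := hf.continuous_fderiv one_ne_zero
  have hgr : Continuous (∇ f) := (InnerProductSpace.toDual ℝ W).symm.continuous.comp hfd
  have hgrb : ∀ x, ‖∇ f x‖ ≤ M' := fun x ↦ by simpa [gradient] using hM' x
  have hM0 : 0 ≤ M := (abs_nonneg _).trans (hM 0)
  have hM0' : 0 ≤ M' := (norm_nonneg _).trans (hM' 0)
  have hint1 : Integrable (fun z : W × W ↦ ‖z.1‖) (γ.prod γ) :=
    (IsGaussian.integrable_id (μ := γ)).norm.comp_fst γ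
  have hint2 : Integrable (fun z : W × W ↦ ‖z.2‖) (γ.prod γ) :=
    (IsGaussian.integrable_id (μ := γ)).norm.comp_snd γ
  have h1 := (hasDerivAt_integral_of_dominated_loc_of_deriv_le (μ := γ.prod γ) (𝕜 := ℝ)
    (F := fun θ z ↦ f z.1 * f (Real.cos θ • z.1 + Real.sin θ • z.2)) (x₀ := θ) (s := Set.univ)
    (F' := fun θ z ↦ f z.1 * fderiv ℝ f (Real.cos θ • z.1 + Real.sin θ • z.2)
      (-Real.sin θ • z.1 + Real.cos θ • z.2))
    (bound := fun z ↦ M * (M' * (‖z.1‖ + ‖z.2‖))) univ_mem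
    (Eventually.of_forall fun θ ↦ Continuous.aestronglyMeasurable (by fun_prop))
    ((integrable_const (M * M)).mono' (Continuous.aestronglyMeasurable (by fun_prop))
      (Eventually.of_forall fun z ↦ ?_)) (Continuous.aestronglyMeasurable (by fun_prop))
    (Eventually.of_forall fun z θ _ ↦ ?_) (((hint1.add hint2).const_mul M').const_mul M)
    (Eventually.of_forall fun z θ _ ↦ ?_)).2
  rotate_left
  · rw [norm_mul]
    exact mul_le_mul (hM _) (hM _) (norm_nonneg _) hM0
  · rw [norm_mul]
    refine mul_le_mul (hM _) ?_ (norm_nonneg _) hM0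
    refine (ContinuousLinearMap.le_opNorm _ _).trans
      (mul_le_mul (hM' _) ?_ (norm_nonneg _) hM0')
    refine (norm_add_le _ _).trans (add_le_add ?_ ?_)
    · rw [norm_smul]
      exact mul_le_of_le_one_left (norm_nonneg _) (by simpa using Real.abs_sin_le_one θ)
    · rw [norm_smul]
      exact mul_le_of_le_one_left (norm_nonneg _) (by simpa using Real.abs_cos_le_one θ)
  · refine HasDerivAt.const_mul _ ?_
    have h : HasDerivAt (fun θ ↦ Real.cos θ • z.1 + Real.sin θ • z.2)
        (-Real.sin θ • z.1 + Real.cos θ • z.2) θ :=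
      ((Real.hasDerivAt_cos θ).smul_const _).add ((Real.hasDerivAt_sin θ).smul_const _)
    exact ((hf.differentiable one_ne_zero _).hasFDerivAt).comp_hasDerivAt θ h
  refine h1.congr_deriv ?_
  set G : W × W → ℝ := fun z ↦
    f (Real.cos (-θ) • z.1 + Real.sin (-θ) • z.2) * ⟪∇ f z.1, z.2⟫ with hG
  have hGc : Continuous G := by fun_prop
  have h2 : ∫ z, f z.1 * fderiv ℝ f (Real.cos θ • z.1 + Real.sin θ • z.2)
      (-Real.sin θ • z.1 + Real.cos θ • z.2) ∂(γ.prod γ) = ∫ z, G z ∂(γ.prod γ) := by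
    have := IsGaussian.map_rotation_eq_self (μ := γ) (by simp [γ]) θ
    conv_rhs => rw [← this]
    rw [integral_map (by fun_prop) hGc.aestronglyMeasurable]
    refine integral_congr_ae (Eventually.of_forall fun z ↦ ?_)
    simp only [hG, ContinuousLinearMap.rotation_apply, inner_gradient_left]
    congr 2
    simp only [Real.cos_neg, Real.sin_neg, smul_add, smul_smul]
    have := Real.cos_sq_add_sin_sq θ
    have e : z.1 = (Real.cos θ * Real.cos θ + Real.sin θ * Real.sin θ) • z.1 := by
      rw [← sq, ← sq, this, one_smul]
    conv_lhs => rw [e]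
    module
  rw [h2, integral_prod, integral_prod (fun z : W × W ↦ ⟪∇ f z.1, _⟫), ← integral_const_mul,
    ← integral_neg]
  · refine integral_congr_ae (Eventually.of_forall fun x ↦ ?_)
    dsimp only
    have hφ : ContDiff ℝ 1 fun y ↦ f (Real.cos (-θ) • x + Real.sin (-θ) • y) := by fun_prop
    have hd : ∀ y, fderiv ℝ (fun y ↦ f (Real.cos (-θ) • x + Real.sin (-θ) • y)) y =
        Real.sin (-θ) • fderiv ℝ f (Real.cos (-θ) • x + Real.sin (-θ) • y) := by
      intro y
      have h : HasFDerivAt (fun y ↦ Real.cos (-θ) • x + Real.sin (-θ) • y)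
          (Real.sin (-θ) • ContinuousLinearMap.id ℝ W) y :=
        ((hasFDerivAt_id y).const_smul _).const_add _
      refine (((hf.differentiable one_ne_zero _).hasFDerivAt).comp y h).fderiv.trans ?_
      ext v
      simp
    have := integral_mul_inner_stdGaussian hφ (M := M) (M' := M') (fun y ↦ hM _) (fun y ↦ ?_)
      (∇ f x)
    · simp only [hG]
      rw [this, ← integral_const_mul, ← integral_neg]
      refine integral_congr_ae (Eventually.of_forall fun y ↦ ?_)
      dsimp only
      rw [hd, real_inner_comm, inner_gradient_left, smul_apply, smul_eq_mul,
        Real.sin_neg, neg_mul]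
    · rw [hd, norm_smul]
      exact (mul_le_of_le_one_left (norm_nonneg _)
        (by simpa using Real.abs_sin_le_one θ)).trans (hM' _)
  · refine (integrable_const (M' * M')).mono' (Continuous.aestronglyMeasurable (by fun_prop))
      (Eventually.of_forall fun z ↦ ?_)
    exact (norm_inner_le_norm _ _).trans (mul_le_mul (hgrb _) (hgrb _) (norm_nonneg _) hM0')
  · refine ((hint2.const_mul M').const_mul M).mono' hGc.aestronglyMeasurable
      (Eventually.of_forall fun z ↦ ?_)
    rw [hG, norm_mul]
    refine mul_le_mul (hM _) ((norm_inner_le_norm _ _).trans ?_) (norm_nonneg _) hM0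
    exact mul_le_mul_of_nonneg_right (hgrb _) (norm_nonneg _)

end Stein

/-! ### The variance inequality for bounded functions -/

section Interpolation

/-- Hölder interpolation of the `L^{1+c}` norm between `L¹` and `L²`; the factor `exp 1` pays for
`1 + log (B / A)` in place of `log (B / A)` in the exponent. -/
lemma lintegral_rpow_le_of_interpolation {X : Type*} [MeasurableSpace X] {μ : Measure X}
    {h : X → ℝ≥0∞} (hm : Measurable h) {A B c : ℝ} (hA : 0 < A) (hAB : A ≤ B) (hc0 : 0 ≤ c)
    (hc1 : c ≤ 1) (h1 : ∫⁻ x, h x ∂μ ≤ ENNReal.ofReal A)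
    (h2 : ∫⁻ x, h x ^ 2 ∂μ ≤ ENNReal.ofReal (B ^ 2)) :
    (∫⁻ x, h x ^ (1 + c) ∂μ) ^ (2 / (1 + c)) ≤
      ENNReal.ofReal (B ^ 2 * (Real.exp 1 * Real.exp (-(1 + Real.log (B / A)) * (1 - c)))) := by
  have hB : 0 < B := hA.trans_le hAB
  have hc2 : 0 ≤ 1 - c := by linarith
  set L := Real.log (B / A) with hL
  have hL0 : 0 ≤ L := Real.log_nonneg ((one_le_div hA).2 hAB)
  have eA : A = B * Real.exp (-L) := by
    rw [hL, Real.exp_neg, Real.exp_log (by positivity)]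
    field_simp
  have e1 : ∀ x, h x ^ (1 + c) = h x ^ (1 - c) * (h x ^ 2) ^ c := by
    intro x
    rw [← ENNReal.rpow_natCast, ← ENNReal.rpow_mul, ← ENNReal.rpow_add_of_nonneg _ _ hc2
      (by positivity)]
    congr 1
    push_cast
    ring
  have e2 : ∫⁻ x, h x ^ (1 + c) ∂μ ≤ ENNReal.ofReal (A ^ (1 - c) * (B ^ 2) ^ c) := by
    simp_rw [e1]
    refine (ENNReal.lintegral_mul_norm_pow_le hm.aemeasurable (hm.pow_const 2).aemeasurable hc2 hc0
      (by ring)).trans ?_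
    rw [ENNReal.ofReal_mul (by positivity), ← ENNReal.ofReal_rpow_of_nonneg hA.le hc2,
      ← ENNReal.ofReal_rpow_of_nonneg (by positivity) hc0]
    gcongr
  have e3 : A ^ (1 - c) * (B ^ 2) ^ c = (B ^ 2 * Real.exp (-(2 * L * (1 - c) / (1 + c)))) ^
      ((1 + c) / 2) := by
    have hB' : B = Real.exp (Real.log B) := (Real.exp_log hB).symm
    rw [eA, hB', ← Real.exp_add, ← Real.exp_nat_mul, ← Real.exp_add, ← Real.exp_mul,
      ← Real.exp_mul, ← Real.exp_mul, ← Real.exp_add]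
    congr 1
    have : 1 + c ≠ 0 := by positivity
    push_cast
    field_simp
    ring
  refine (ENNReal.rpow_le_rpow e2 (by positivity)).trans ?_
  rw [ENNReal.ofReal_rpow_of_nonneg (by positivity) (by positivity), e3,
    ← Real.rpow_mul (by positivity), show (1 + c) / 2 * (2 / (1 + c)) = 1 by field_simp,
    Real.rpow_one, ← Real.exp_add]
  refine ENNReal.ofReal_le_ofReal ?_
  gcongr
  have : L * (1 - c) ≤ 2 * L * (1 - c) / (1 + c) := by
    rw [le_div_iff₀ (by positivity)]
    nlinarith [mul_nonneg hL0 hc2]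
  nlinarith

end Interpolation

section Variance

variable {W : Type*} [NormedAddCommGroup W] [InnerProductSpace ℝ W] [FiniteDimensional ℝ W]
  {ι : Type*} [Fintype ι]

lemma inner_eq_sum_of_decomposition {E : ι → Submodule ℝ W} {c : ι → ℝ}
    (hdecomp : ContinuousLinearMap.id ℝ W = ∑ i, c i • (E i).starProjection) (u v : W) :
    ⟪u, v⟫ = ∑ i, c i * ⟪(E i).starProjection u, (E i).starProjection v⟫ := by
  conv_lhs => rw [← ContinuousLinearMap.id_apply (R₁ := ℝ) v, hdecomp]
  simp only [sum_apply, smul_apply, inner_sum,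
    real_inner_smul_right]
  refine Finset.sum_congr rfl fun i _ ↦ ?_
  rw [Submodule.inner_starProjection_left_eq_right,
    Submodule.starProjection_eq_self_iff.2 ((E i).starProjection_apply_mem v)]

variable [MeasurableSpace W] [BorelSpace W]

/-- The correlation of gradients is estimated, subspace by subspace, by hypercontractivity and
interpolation. -/
lemma integral_inner_gradient_le {E : ι → Submodule ℝ W} {c : ι → ℝ} (hc : ∀ i, 0 < c i)
    (hdecomp : ContinuousLinearMap.id ℝ W = ∑ i, c i • (E i).starProjection)
    {f : W → ℝ} (hf : ContDiff ℝ 1 f) {M' : ℝ} (hM' : ∀ x, ‖fderiv ℝ f x‖ ≤ M')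
    {A B : ι → ℝ} (hA : ∀ i, 0 < A i) (hAB : ∀ i, A i ≤ B i)
    (h1 : ∀ i, ∫⁻ x, ‖(E i).starProjection (∇ f x)‖ₑ ∂(stdGaussian W) ≤ ENNReal.ofReal (A i))
    (h2 : ∀ i, ∫⁻ x, ‖(E i).starProjection (∇ f x)‖ₑ ^ 2 ∂(stdGaussian W) ≤
      ENNReal.ofReal (B i ^ 2)) {θ : ℝ} (hθ : 0 ≤ Real.cos θ) :
    ∫ z, ⟪∇ f z.1, ∇ f (Real.cos θ • z.1 + Real.sin θ • z.2)⟫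
        ∂((stdGaussian W).prod (stdGaussian W)) ≤
      ∑ i, c i * (B i ^ 2 * (Real.exp 1 *
        Real.exp (-(1 + Real.log (B i / A i)) * (1 - Real.cos θ)))) := by
  have hgr : Continuous (∇ f) :=
    (InnerProductSpace.toDual ℝ W).symm.continuous.comp (hf.continuous_fderiv one_ne_zero)
  have hgrb : ∀ x, ‖∇ f x‖ ≤ M' := fun x ↦ by simpa [gradient] using hM' x
  have hM0' : 0 ≤ M' := (norm_nonneg _).trans (hM' 0)
  have hQc : ∀ i, Continuous fun x ↦ (E i).starProjection (∇ f x) := fun i ↦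
    (E i).starProjection.continuous.comp hgr
  have hQb : ∀ i x, ‖(E i).starProjection (∇ f x)‖ ≤ M' := fun i x ↦
    ((E i).norm_starProjection_apply_le _).trans (hgrb x)
  have hint : ∀ i, Integrable (fun z : W × W ↦ ‖(E i).starProjection (∇ f z.1)‖ *
      ‖(E i).starProjection (∇ f (Real.cos θ • z.1 + Real.sin θ • z.2))‖)
      ((stdGaussian W).prod (stdGaussian W)) := by
    intro i
    have := hQc i
    refine (integrable_const (M' * M')).mono' (Continuous.aestronglyMeasurable (by fun_prop))
      (Eventually.of_forall fun z ↦ ?_)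
    rw [norm_mul, norm_norm, norm_norm]
    exact mul_le_mul (hQb _ _) (hQb _ _) (norm_nonneg _) hM0'
  calc ∫ z, ⟪∇ f z.1, ∇ f (Real.cos θ • z.1 + Real.sin θ • z.2)⟫
        ∂((stdGaussian W).prod (stdGaussian W))
      ≤ ∫ z, ∑ i, c i * (‖(E i).starProjection (∇ f z.1)‖ *
          ‖(E i).starProjection (∇ f (Real.cos θ • z.1 + Real.sin θ • z.2))‖)
          ∂((stdGaussian W).prod (stdGaussian W)) := by
        refine integral_mono ?_ (integrable_finsetSum _ fun i _ ↦ (hint i).const_mul _) fun z ↦ ?_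
        · refine (integrable_const (M' * M')).mono' (Continuous.aestronglyMeasurable (by fun_prop))
            (Eventually.of_forall fun z ↦ ?_)
          exact (norm_inner_le_norm _ _).trans (mul_le_mul (hgrb _) (hgrb _) (norm_nonneg _) hM0')
        · dsimp only
          rw [inner_eq_sum_of_decomposition hdecomp]
          exact Finset.sum_le_sum fun i _ ↦
            mul_le_mul_of_nonneg_left (real_inner_le_norm _ _) (hc i).le
    _ = ∑ i, c i * ∫ z, ‖(E i).starProjection (∇ f z.1)‖ *
          ‖(E i).starProjection (∇ f (Real.cos θ • z.1 + Real.sin θ • z.2))‖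
          ∂((stdGaussian W).prod (stdGaussian W)) := by
        rw [integral_finsetSum _ fun i _ ↦ (hint i).const_mul _]
        simp_rw [integral_const_mul]
    _ ≤ _ := by
        refine Finset.sum_le_sum fun i _ ↦ mul_le_mul_of_nonneg_left ?_ (hc i).le
        rw [integral_eq_lintegral_of_nonneg_ae (Eventually.of_forall fun z ↦ by positivity)
          (hint i).aestronglyMeasurable]
        refine ENNReal.toReal_le_of_le_ofReal (by positivity) ?_
        have h := lintegral_mul_le_of_correlated hθ (h := fun x ↦ ‖(E i).starProjection (∇ f x)‖₊)
          (hQc i).nnnorm (M := M'.toNNReal)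
          fun x ↦ NNReal.le_toNNReal_of_coe_le (hQb i x)
        have h' := lintegral_rpow_le_of_interpolation (μ := stdGaussian W)
          (h := fun x ↦ ‖(E i).starProjection (∇ f x)‖ₑ) (hQc i).enorm.measurable (hA i) (hAB i)
          hθ (Real.cos_le_one θ) (h1 i) (h2 i)
        refine le_trans (le_of_eq ?_) (h.trans h')
        refine lintegral_congr fun z ↦ ?_
        rw [ENNReal.ofReal_mul (norm_nonneg _), ofReal_norm, ofReal_norm]
        rfl

/-- The variance inequality for bounded Lipschitz `C¹` functions, with any upper bounds `A i` and
`B i` of the `L¹` and `L²` norms of the projected gradients. -/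
lemma variance_le_of_bounded {E : ι → Submodule ℝ W} {c : ι → ℝ} (hc : ∀ i, 0 < c i)
    (hdecomp : ContinuousLinearMap.id ℝ W = ∑ i, c i • (E i).starProjection)
    {f : W → ℝ} (hf : ContDiff ℝ 1 f) {M M' : ℝ} (hM : ∀ x, |f x| ≤ M)
    (hM' : ∀ x, ‖fderiv ℝ f x‖ ≤ M')
    {A B : ι → ℝ} (hA : ∀ i, 0 < A i) (hAB : ∀ i, A i ≤ B i)
    (h1 : ∀ i, ∫⁻ x, ‖(E i).starProjection (∇ f x)‖ₑ ∂(stdGaussian W) ≤ ENNReal.ofReal (A i))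
    (h2 : ∀ i, ∫⁻ x, ‖(E i).starProjection (∇ f x)‖ₑ ^ 2 ∂(stdGaussian W) ≤
      ENNReal.ofReal (B i ^ 2)) :
    Var[f; stdGaussian W] ≤
      ∑ i, c i * (Real.exp 1 * (B i ^ 2 / (1 + Real.log (B i / A i)))) := by
  set γ := stdGaussian W
  set L : ι → ℝ := fun i ↦ Real.log (B i / A i) with hL
  have hL0 : ∀ i, 0 ≤ L i := fun i ↦ Real.log_nonneg ((one_le_div (hA i)).2 (hAB i))
  set Φ : ℝ → ℝ := fun θ ↦ ∫ z, f z.1 * f (Real.cos θ • z.1 + Real.sin θ • z.2) ∂(γ.prod γ) with hΦ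
  set G : ℝ → ℝ := fun θ ↦ ∑ i, c i * (Real.exp 1 * (B i ^ 2 / (1 + L i) *
    Real.exp (-(1 + L i) * (1 - Real.cos θ)))) with hG
  have hGd : ∀ θ, HasDerivAt G (∑ i, c i * (Real.exp 1 * (B i ^ 2 / (1 + L i) *
      (Real.exp (-(1 + L i) * (1 - Real.cos θ)) * (-(1 + L i) * Real.sin θ))))) θ := by
    intro θ
    refine HasDerivAt.fun_sum fun i _ ↦ ?_
    refine HasDerivAt.const_mul _ (HasDerivAt.const_mul _ (HasDerivAt.const_mul _ ?_))
    refine HasDerivAt.exp (HasDerivAt.const_mul _ ?_)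
    simpa using (Real.hasDerivAt_cos θ).const_sub 1
  have hd := fun θ ↦ (hasDerivAt_integral_correlated hf hM hM' θ).sub (hGd θ)
  -- `Φ - G` increases, since the correlation estimate for the gradients gives `G' ≤ Φ'`
  have hmono : MonotoneOn (fun θ ↦ Φ θ - G θ) (Set.Icc 0 (Real.pi / 2)) := by
    refine monotoneOn_of_deriv_nonneg (convex_Icc _ _)
      (fun θ _ ↦ (hd θ).continuousAt.continuousWithinAt)
      (fun θ _ ↦ (hd θ).differentiableAt.differentiableWithinAt) fun θ hθ ↦ ?_
    rw [interior_Icc] at hθ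
    have hcos : 0 ≤ Real.cos θ :=
      Real.cos_nonneg_of_mem_Icc ⟨by linarith [hθ.1, Real.pi_pos], hθ.2.le⟩
    have hsin : 0 ≤ Real.sin θ :=
      Real.sin_nonneg_of_nonneg_of_le_pi hθ.1.le (by linarith [hθ.2, Real.pi_pos])
    have h := integral_inner_gradient_le hc hdecomp hf hM' hA hAB h1 h2 (θ := -θ)
      (by rwa [Real.cos_neg])
    have e : deriv (fun θ ↦ Φ θ - G θ) θ = _ := (hd θ).deriv
    rw [e]
    have e2 : ∑ i, c i * (Real.exp 1 * (B i ^ 2 / (1 + L i) *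
        (Real.exp (-(1 + L i) * (1 - Real.cos θ)) * (-(1 + L i) * Real.sin θ)))) =
        -(Real.sin θ * ∑ i, c i * (B i ^ 2 * (Real.exp 1 *
          Real.exp (-(1 + L i) * (1 - Real.cos (-θ)))))) := by
      rw [Finset.mul_sum, ← Finset.sum_neg_distrib, Real.cos_neg]
      refine Finset.sum_congr rfl fun i _ ↦ ?_
      have : 1 + L i ≠ 0 := by linarith [hL0 i]
      field_simp
    rw [e2]
    have := mul_le_mul_of_nonneg_left h hsin
    linarith
  have hpi : 0 ≤ Real.pi / 2 := by positivity
  have h : Φ 0 - G 0 ≤ Φ (Real.pi / 2) - G (Real.pi / 2) :=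
    hmono (Set.left_mem_Icc.2 hpi) (Set.right_mem_Icc.2 hpi) hpi
  have hc0 : Continuous f := hf.continuous
  have hΦ0 : Φ 0 = ∫ x, f x ^ 2 ∂γ := by
    simp only [hΦ, Real.cos_zero, Real.sin_zero, one_smul, zero_smul, add_zero]
    rw [← integral_map (f := fun x ↦ f x * f x) (by fun_prop)
      (Continuous.aestronglyMeasurable (by fun_prop)), Measure.map_fst_prod, measure_univ, one_smul]
    simp only [sq]
  have hΦ1 : Φ (Real.pi / 2) = (∫ x, f x ∂γ) ^ 2 := by
    simp only [hΦ, Real.cos_pi_div_two, Real.sin_pi_div_two, one_smul, zero_smul, zero_add]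
    rw [integral_prod_mul, sq]
  have hG0 : G 0 = ∑ i, c i * (Real.exp 1 * (B i ^ 2 / (1 + L i))) := by simp [hG]
  have hG1 : 0 ≤ G (Real.pi / 2) := Finset.sum_nonneg fun i _ ↦ by
    have := hL0 i
    have := hc i
    positivity
  have hmem : MemLp f 2 γ :=
    MemLp.of_bound hc0.aestronglyMeasurable M (Eventually.of_forall hM)
  rw [variance_eq_sub hmem]
  rw [hΦ0, hΦ1, hG0] at h
  simp only [Pi.pow_apply]
  linarith

end Variance

/-! ### Truncation and the double integral of squared differences -/

section Truncation

variable {W : Type*} [NormedAddCommGroup W] [InnerProductSpace ℝ W] [FiniteDimensional ℝ W]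

/-- Truncation: `f` is the pointwise limit of the compactly supported functions
`χ (x / k ^ 2) * (k * sin (f x / k))`, whose gradients are those of `f`, contracted by a scalar
factor, up to a uniformly small error. -/
lemma exists_compactly_supported_approximation {f : W → ℝ} (hf : ContDiff ℝ 1 f) :
    ∃ (F : ℕ → W → ℝ) (δ : ℕ → ℝ), (∀ k, 0 < δ k) ∧ Tendsto δ atTop (𝓝 0) ∧
      (∀ k, ContDiff ℝ 1 (F k)) ∧ (∀ k, HasCompactSupport (F k)) ∧
      (∀ x, Tendsto (fun k ↦ F k x) atTop (𝓝 (f x))) ∧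
      ∀ k x, ∃ (a : ℝ) (w : W), |a| ≤ 1 ∧ ‖w‖ ≤ δ k ∧ ∇ (F k) x = a • ∇ f x + w := by
  obtain ⟨χ, -, hχs, hχ, hχr, hχ0⟩ :=
    exists_contDiff_tsupport_subset (E := W) (s := Set.univ) (x := 0) (n := 1) univ_mem
  replace hχ : ContDiff ℝ 1 χ := by exact_mod_cast hχ
  obtain ⟨C, hC⟩ := (hχ.continuous_fderiv one_ne_zero).bounded_above_of_compact_support
    (hχs.fderiv ℝ)
  have hC0 : 0 ≤ C := (norm_nonneg _).trans (hC 0)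
  have hk0 : ∀ k : ℕ, (0 : ℝ) < k + 1 := fun k ↦ by positivity
  have hlim : Tendsto (fun k : ℕ ↦ 1 / ((k : ℝ) + 1)) atTop (𝓝 0) :=
    tendsto_one_div_add_atTop_nhds_zero_nat
  refine ⟨fun k x ↦ χ ((1 / ((k : ℝ) + 1) ^ 2) • x) * ((k + 1) * Real.sin (f x / (k + 1))),
    fun k ↦ (C + 1) * (1 / (k + 1)), fun k ↦ ?_, ?_, fun k ↦ ?_, fun k ↦ ?_, fun x ↦ ?_,
    fun k x ↦ ?_⟩
  · have := hk0 k
    positivity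
  · simpa using hlim.const_mul (C + 1)
  · have h1 : ContDiff ℝ 1 fun x : W ↦ χ ((1 / ((k : ℝ) + 1) ^ 2) • x) :=
      hχ.comp (contDiff_const_smul _)
    have h2 : ContDiff ℝ 1 fun x : W ↦ Real.sin (f x / (k + 1)) :=
      Real.contDiff_sin.comp (hf.div_const _)
    exact h1.mul (contDiff_const.mul h2)
  · have : (1 / ((k : ℝ) + 1) ^ 2) ≠ 0 := by
      have := hk0 k
      positivity
    exact (hχs.comp_smul this).mul_right
  · have h1 : Tendsto (fun k : ℕ ↦ χ ((1 / ((k : ℝ) + 1) ^ 2) • x)) atTop (𝓝 1) := by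
      have h : Tendsto (fun k : ℕ ↦ (1 / ((k : ℝ) + 1) ^ 2) • x) atTop (𝓝 0) := by
        have := (hlim.pow 2).smul_const x
        simpa using this
      have h' := (hχ.continuous.tendsto 0).comp h
      rwa [hχ0] at h'
    have h2 : Tendsto (fun k : ℕ ↦ f x * Real.sinc (f x * (1 / ((k : ℝ) + 1)))) atTop
        (𝓝 (f x)) := by
      have h := hlim.const_mul (f x)
      rw [mul_zero] at h
      simpa using ((Real.continuous_sinc.tendsto 0).comp h).const_mul (f x)
    have h3 := h1.mul h2
    rw [one_mul] at h3
    refine h3.congr fun k ↦ ?_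
    have := (hk0 k).ne'
    rcases eq_or_ne (f x) 0 with h | h
    · simp [h]
    · rw [Real.sinc_of_ne_zero (by positivity), mul_one_div]
      field_simp
  · have hk := hk0 k
    set r : ℝ := 1 / ((k : ℝ) + 1) ^ 2 with hr
    have hd1 : HasFDerivAt (fun x : W ↦ χ (r • x))
        ((fderiv ℝ χ (r • x)).comp (r • ContinuousLinearMap.id ℝ W)) x :=
      ((hχ.differentiable one_ne_zero _).hasFDerivAt).comp x ((hasFDerivAt_id x).const_smul r)
    have hd2 : HasFDerivAt (fun x : W ↦ ((k : ℝ) + 1) * Real.sin (f x / (k + 1)))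
        (Real.cos (f x / (k + 1)) • fderiv ℝ f x) x := by
      have h := ((Real.hasDerivAt_sin (f x / (k + 1))).comp_hasFDerivAt x
        (((hf.differentiable one_ne_zero x).hasFDerivAt).mul_const ((k : ℝ) + 1)⁻¹)).const_mul
          ((k : ℝ) + 1)
      refine h.congr_fderiv ?_
      ext v
      simp only [smul_apply, smul_eq_mul]
      field_simp
    have hd := hd1.mul hd2
    refine ⟨χ (r • x) * Real.cos (f x / (k + 1)),
      (((k : ℝ) + 1) * Real.sin (f x / (k + 1)) * r) • ∇ χ (r • x), ?_, ?_, ?_⟩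
    · rw [abs_mul]
      refine mul_le_one₀ (abs_le.2 ⟨?_, ?_⟩) (abs_nonneg _) (Real.abs_cos_le_one _)
      · linarith [(hχr ⟨r • x, rfl⟩).1]
      · exact (hχr ⟨r • x, rfl⟩).2
    · have h1 : ‖∇ χ (r • x)‖ ≤ C := by simpa [gradient] using hC (r • x)
      rw [norm_smul, norm_mul, norm_mul, Real.norm_of_nonneg hk.le,
        Real.norm_of_nonneg (show 0 ≤ r by positivity)]
      have h2 : ((k : ℝ) + 1) * ‖Real.sin (f x / (k + 1))‖ * r ≤ (k + 1) * 1 * r := by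
        gcongr
        exact Real.abs_sin_le_one _
      have h3 : ((k : ℝ) + 1) * 1 * r = 1 / (k + 1) := by
        rw [hr]; field_simp
      rw [h3] at h2
      calc _ ≤ 1 / ((k : ℝ) + 1) * C := mul_le_mul h2 h1 (norm_nonneg _) (by positivity)
        _ ≤ (C + 1) * (1 / (k + 1)) := by
          rw [mul_comm]; gcongr; linarith
    · refine (congrArg (InnerProductSpace.toDual ℝ W).symm hd.fderiv).trans ?_
      simp only [gradient, map_add, map_smulₛₗ, ContinuousLinearMap.comp_smul,
        ContinuousLinearMap.comp_id, smul_smul, conj_trivial]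

end Truncation

section DoubleIntegral

variable {X : Type*} [MeasurableSpace X] {μ : Measure X} [IsProbabilityMeasure μ]

lemma lintegral_enorm_sub_sq_eq_two_mul_variance {f : X → ℝ} (hf : MemLp f 2 μ) :
    ∫⁻ z, ‖f z.1 - f z.2‖ₑ ^ 2 ∂(μ.prod μ) = ENNReal.ofReal (2 * Var[f; μ]) := by
  have h1 : MemLp (fun z : X × X ↦ f z.1) 2 (μ.prod μ) := hf.comp_fst μ
  have h2 : MemLp (fun z : X × X ↦ -f z.2) 2 (μ.prod μ) := hf.neg.comp_snd μ
  have h3 : MemLp (fun z : X × X ↦ f z.1 + -f z.2) 2 (μ.prod μ) := h1.add h2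
  have h4 : Var[fun z : X × X ↦ f z.1 + -f z.2; μ.prod μ] = 2 * Var[f; μ] := by
    have h := variance_add_prod hf hf.neg
    simp only [Pi.neg_apply] at h
    rw [h, variance_neg]
    ring
  have h5 : ∫ z, (f z.1 + -f z.2) ∂(μ.prod μ) = 0 := by
    rw [integral_add (h1.integrable one_le_two) (h2.integrable one_le_two), integral_neg,
      integral_fun_fst (μ := μ) (ν := μ), integral_fun_snd (μ := μ) (ν := μ)]
    simp
  rw [← h4, h3.ofReal_variance_eq, evariance, h5]
  simp only [sub_zero]
  simp only [sub_eq_add_neg]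

/-- Square integrability from the double integral: `f - f y` is square integrable for almost
every `y`. -/
lemma memLp_two_of_lintegral_enorm_sub_sq_ne_top {f : X → ℝ} (hf : Measurable f)
    (h : ∫⁻ z, ‖f z.1 - f z.2‖ₑ ^ 2 ∂(μ.prod μ) ≠ ⊤) : MemLp f 2 μ := by
  rw [lintegral_prod_symm' _ (by fun_prop)] at h
  have h1 := ae_lt_top (Measurable.lintegral_prod_left'
    (f := fun z : X × X ↦ ‖f z.1 - f z.2‖ₑ ^ 2) (by fun_prop)) h
  obtain ⟨y, hy⟩ := h1.exists
  have h2 : MemLp (fun x ↦ f x - f y) 2 μ := by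
    refine ⟨by fun_prop, ?_⟩
    rw [eLpNorm_lt_top_iff_lintegral_rpow_enorm_lt_top two_ne_zero ENNReal.ofNat_ne_top]
    simpa using hy
  refine (h2.add (memLp_const (f y))).congr_norm hf.aestronglyMeasurable
    (Eventually.of_forall fun x ↦ ?_)
  simp

end DoubleIntegral

/-! ### The general variance inequality -/

section TalagrandInequality

lemma eLpNorm_le_add_of_norm_le_add {X F : Type*} [MeasurableSpace X] [NormedAddCommGroup F]
    {μ : Measure X} [IsProbabilityMeasure μ] {g g' : X → F} (hg : AEStronglyMeasurable g μ)
    {δ : ℝ} (hδ : 0 ≤ δ) (h : ∀ x, ‖g' x‖ ≤ ‖g x‖ + δ) {p : ℝ≥0∞} (hp : 1 ≤ p) :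
    eLpNorm g' p μ ≤ eLpNorm g p μ + ENNReal.ofReal δ := by
  refine (eLpNorm_mono_real h).trans ?_
  refine (eLpNorm_add_le (f := fun x ↦ ‖g x‖) (g := fun _ ↦ δ) hg.norm
    aestronglyMeasurable_const hp).trans ?_
  rw [eLpNorm_norm, eLpNorm_const _ (by positivity) (IsProbabilityMeasure.ne_zero μ), measure_univ,
    ENNReal.one_rpow, mul_one, Real.enorm_of_nonneg hδ]

lemma log_eLpNorm_div_eLpNorm_nonneg {X F : Type*} [MeasurableSpace X] [NormedAddCommGroup F]
    {μ : Measure X} [IsProbabilityMeasure μ] {g : X → F} (hg : AEStronglyMeasurable g μ)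
    (hfin : eLpNorm g 2 μ ≠ ⊤) :
    0 ≤ Real.log ((eLpNorm g 2 μ).toReal / (eLpNorm g 1 μ).toReal) := by
  rcases (ENNReal.toReal_nonneg (a := eLpNorm g 1 μ)).eq_or_lt with h | h
  · simp [← h]
  · exact Real.log_nonneg ((one_le_div h).2
      (ENNReal.toReal_mono hfin (eLpNorm_le_eLpNorm_of_exponent_le one_le_two hg)))

/-- The right-hand side for the enlarged norms `a + δ` and `b + δ` tends to the one for `a` and `b`,
also when `a = b = 0`: then `log (b / a)` is the junk value `0` and both sides vanish. -/
lemma tendsto_sq_div_one_add_log {a b : ℝ} (ha : 0 ≤ a) (hab : a ≤ b) (h0 : a = 0 → b = 0)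
    {δ : ℕ → ℝ} (hδ : ∀ k, 0 < δ k) (hδ0 : Tendsto δ atTop (𝓝 0)) :
    Tendsto (fun k ↦ (b + δ k) ^ 2 / (1 + Real.log ((b + δ k) / (a + δ k)))) atTop
      (𝓝 (b ^ 2 / (1 + Real.log (b / a)))) := by
  have hb : Tendsto (fun k ↦ b + δ k) atTop (𝓝 b) := by simpa using hδ0.const_add b
  have ha' : Tendsto (fun k ↦ a + δ k) atTop (𝓝 a) := by simpa using hδ0.const_add a
  rcases ha.eq_or_lt with rfl | ha
  · obtain rfl := h0 rfl
    have : ∀ k, (0 + δ k) / (0 + δ k) = 1 := fun k ↦ div_self (by simpa using (hδ k).ne')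
    simp_rw [this]
    simpa using hδ0.pow 2
  · have hlog : 0 ≤ Real.log (b / a) := Real.log_nonneg ((one_le_div ha).2 hab)
    have hne : b / a ≠ 0 := (div_pos (ha.trans_le hab) ha).ne'
    exact (hb.pow 2).div (((hb.div ha' ha.ne').log hne).const_add 1) (by positivity)

variable {W : Type*} [NormedAddCommGroup W] [InnerProductSpace ℝ W] [FiniteDimensional ℝ W]
  [MeasurableSpace W] [BorelSpace W] {ι : Type*} [Fintype ι]

/-- The variance inequality for `C¹` functions with square integrable projected gradients. -/
lemma evariance_le_of_eLpNorm_gradient_ne_top {E : ι → Submodule ℝ W} {c : ι → ℝ}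
    (hc : ∀ i, 0 < c i)
    (hdecomp : ContinuousLinearMap.id ℝ W = ∑ i, c i • (E i).starProjection)
    {f : W → ℝ} (hf : ContDiff ℝ 1 f)
    (hfin : ∀ i, eLpNorm (fun x ↦ (E i).starProjection (∇ f x)) 2 (stdGaussian W) ≠ ⊤) :
    evariance f (stdGaussian W) ≤ ENNReal.ofReal (∑ i, c i * (Real.exp 1 *
      ((eLpNorm (fun x ↦ (E i).starProjection (∇ f x)) 2 (stdGaussian W)).toReal ^ 2 /
        (1 + Real.log ((eLpNorm (fun x ↦ (E i).starProjection (∇ f x)) 2 (stdGaussian W)).toReal /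
          (eLpNorm (fun x ↦ (E i).starProjection (∇ f x)) 1 (stdGaussian W)).toReal))))) := by
  set γ := stdGaussian W
  set g : ι → W → W := fun i x ↦ (E i).starProjection (∇ f x) with hg
  have hgc : ∀ i, Continuous (g i) := fun i ↦ (E i).starProjection.continuous.comp
    ((InnerProductSpace.toDual ℝ W).symm.continuous.comp (hf.continuous_fderiv one_ne_zero))
  have hgm : ∀ i, AEStronglyMeasurable (g i) γ := fun i ↦ (hgc i).aestronglyMeasurable
  have h12 : ∀ i, eLpNorm (g i) 1 γ ≤ eLpNorm (g i) 2 γ := fun i ↦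
    eLpNorm_le_eLpNorm_of_exponent_le one_le_two (hgm i)
  have hfin1 : ∀ i, eLpNorm (g i) 1 γ ≠ ⊤ := fun i ↦ ne_top_of_le_ne_top (hfin i) (h12 i)
  set a : ι → ℝ := fun i ↦ (eLpNorm (g i) 1 γ).toReal with ha
  set b : ι → ℝ := fun i ↦ (eLpNorm (g i) 2 γ).toReal with hb
  have ha0 : ∀ i, 0 ≤ a i := fun i ↦ ENNReal.toReal_nonneg
  have hab : ∀ i, a i ≤ b i := fun i ↦ ENNReal.toReal_mono (hfin i) (h12 i)
  have hab0 : ∀ i, a i = 0 → b i = 0 := by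
    intro i h
    have h1 : eLpNorm (g i) 1 γ = 0 := by
      simpa [ha, ENNReal.toReal_eq_zero_iff, hfin1 i] using h
    have h2 : eLpNorm (g i) 2 γ = 0 := by
      rw [eLpNorm_eq_zero_iff (hgm i) two_ne_zero]
      exact (eLpNorm_eq_zero_iff (hgm i) one_ne_zero).1 h1
    simp [hb, h2]
  obtain ⟨F, δ, hδ, hδ0, hF, hFs, hFlim, hFg⟩ := exists_compactly_supported_approximation hf
  -- the truncated functions satisfy the inequality with norms enlarged by `δ k`
  have hvar : ∀ k, Var[F k; γ] ≤ ∑ i, c i * (Real.exp 1 *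
      ((b i + δ k) ^ 2 / (1 + Real.log ((b i + δ k) / (a i + δ k))))) := by
    intro k
    obtain ⟨M, hM⟩ := (hF k).continuous.bounded_above_of_compact_support (hFs k)
    obtain ⟨M', hM'⟩ := ((hF k).continuous_fderiv one_ne_zero).bounded_above_of_compact_support
      ((hFs k).fderiv ℝ)
    have hnorm : ∀ i x, ‖(E i).starProjection (∇ (F k) x)‖ ≤ ‖g i x‖ + δ k := by
      intro i x
      obtain ⟨t, w, ht, hw, he⟩ := hFg k x
      rw [he, map_add, map_smul]
      refine (norm_add_le _ _).trans (add_le_add ?_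
        (((E i).norm_starProjection_apply_le w).trans hw))
      rw [norm_smul]
      exact mul_le_of_le_one_left (norm_nonneg _) ht
    have hL : ∀ i (p : ℝ≥0∞), 1 ≤ p → eLpNorm (g i) p γ ≠ ⊤ →
        eLpNorm (fun x ↦ (E i).starProjection (∇ (F k) x)) p γ ≤
          ENNReal.ofReal ((eLpNorm (g i) p γ).toReal + δ k) := by
      intro i p hp hpt
      refine (eLpNorm_le_add_of_norm_le_add (hgm i) (hδ k).le (hnorm i) hp).trans (le_of_eq ?_)
      rw [ENNReal.ofReal_add ENNReal.toReal_nonneg (hδ k).le, ENNReal.ofReal_toReal hpt]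
    refine variance_le_of_bounded hc hdecomp (hF k) hM hM' (A := fun i ↦ a i + δ k)
      (B := fun i ↦ b i + δ k) (fun i ↦ by linarith [ha0 i, hδ k]) (fun i ↦ by linarith [hab i])
      (fun i ↦ ?_) fun i ↦ ?_
    · rw [← eLpNorm_one_eq_lintegral_enorm]
      exact hL i 1 le_rfl (hfin1 i)
    · have h := hL i 2 one_le_two (hfin i)
      have e := eLpNorm_nnreal_pow_eq_lintegral (μ := γ) (p := 2)
        (f := fun x ↦ (E i).starProjection (∇ (F k) x)) two_ne_zero
      simp only [NNReal.coe_ofNat, ENNReal.rpow_ofNat, ENNReal.coe_ofNat] at e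
      rw [← e, ENNReal.ofReal_pow (by linarith [ha0 i, hab i, hδ k])]
      gcongr
  set S := ∑ i, c i * (Real.exp 1 * (b i ^ 2 / (1 + Real.log (b i / a i)))) with hS
  have hlim : Tendsto (fun k ↦ ENNReal.ofReal (2 * ∑ i, c i * (Real.exp 1 *
      ((b i + δ k) ^ 2 / (1 + Real.log ((b i + δ k) / (a i + δ k))))))) atTop
      (𝓝 (ENNReal.ofReal (2 * S))) :=
    ENNReal.tendsto_ofReal ((tendsto_finsetSum _ fun i _ ↦ ((tendsto_sq_div_one_add_log (ha0 i)
      (hab i) (hab0 i) hδ hδ0).const_mul _).const_mul _).const_mul _)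
  have hfm : Measurable f := hf.continuous.measurable
  -- Fatou's lemma for the double integral, which does not see the means of the truncated functions
  have hD : ∫⁻ z, ‖f z.1 - f z.2‖ₑ ^ 2 ∂(γ.prod γ) ≤ ENNReal.ofReal (2 * S) := by
    have hpt : ∀ z : W × W, ‖f z.1 - f z.2‖ₑ ^ 2 =
        liminf (fun k ↦ ‖F k z.1 - F k z.2‖ₑ ^ 2) atTop := by
      intro z
      refine (Tendsto.liminf_eq ?_).symm
      have h1 := ((hFlim z.1).sub (hFlim z.2)).enorm
      exact ((ENNReal.continuous_pow 2).tendsto _).comp h1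
    calc ∫⁻ z, ‖f z.1 - f z.2‖ₑ ^ 2 ∂(γ.prod γ)
        = ∫⁻ z, liminf (fun k ↦ ‖F k z.1 - F k z.2‖ₑ ^ 2) atTop ∂(γ.prod γ) :=
          lintegral_congr hpt
      _ ≤ liminf (fun k ↦ ∫⁻ z, ‖F k z.1 - F k z.2‖ₑ ^ 2 ∂(γ.prod γ)) atTop := by
          refine lintegral_liminf_le fun k ↦ ?_
          have := (hF k).continuous
          fun_prop
      _ ≤ liminf (fun k ↦ ENNReal.ofReal (2 * ∑ i, c i * (Real.exp 1 *
            ((b i + δ k) ^ 2 / (1 + Real.log ((b i + δ k) / (a i + δ k))))))) atTop := by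
          refine liminf_le_liminf (Eventually.of_forall fun k ↦ ?_)
          rw [lintegral_enorm_sub_sq_eq_two_mul_variance
            ((hF k).continuous.memLp_of_hasCompactSupport (hFs k))]
          exact ENNReal.ofReal_le_ofReal (by linarith [hvar k])
      _ = _ := hlim.liminf_eq
  have hmem : MemLp f 2 γ := memLp_two_of_lintegral_enorm_sub_sq_ne_top hfm
    (ne_top_of_le_ne_top ENNReal.ofReal_ne_top hD)
  have hS0 : 0 ≤ S := by
    refine Finset.sum_nonneg fun i _ ↦ ?_
    have h1 := (hc i).le
    have h2 : 0 ≤ Real.log (b i / a i) := log_eLpNorm_div_eLpNorm_nonneg (hgm i) (hfin i)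
    positivity
  rw [lintegral_enorm_sub_sq_eq_two_mul_variance hmem,
    ENNReal.ofReal_le_ofReal_iff (by positivity)] at hD
  rw [← hmem.ofReal_variance_eq]
  exact ENNReal.ofReal_le_ofReal (by linarith)

end TalagrandInequality

theorem corollary5 (n m : ℕ)
    (E : Fin m → Submodule ℝ (EuclideanSpace ℝ (Fin n))) (c : Fin m → ℝ)
    (hc : ∀ i, 0 < c i)
    (hdecomp : ContinuousLinearMap.id ℝ (EuclideanSpace ℝ (Fin n)) =
      ∑ i, c i • (E i).starProjection)
    (f : EuclideanSpace ℝ (Fin n) → ℝ) (hf : ContDiff ℝ ∞ f) :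
    evariance f (stdGaussian (EuclideanSpace ℝ (Fin n))) ≤
      4 * ∑ i, ENNReal.ofReal (c i) *
        talagrandTerm (stdGaussian (EuclideanSpace ℝ (Fin n)))
          (fun x => (E i).starProjection (gradient f x)) := by
  by_cases hfin : ∀ i, eLpNorm (fun x ↦ (E i).starProjection (∇ f x)) 2
      (stdGaussian (EuclideanSpace ℝ (Fin n))) ≠ ⊤
  · refine (evariance_le_of_eLpNorm_gradient_ne_top hc hdecomp (hf.of_le (by simp)) hfin).trans ?_
    have hgr : Continuous (∇ f) := (InnerProductSpace.toDual ℝ _).symm.continuous.comp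
      (hf.continuous_fderiv (by simp))
    set T : Fin m → ℝ := fun i ↦ (eLpNorm (fun x ↦ (E i).starProjection (∇ f x)) 2
        (stdGaussian (EuclideanSpace ℝ (Fin n)))).toReal ^ 2 /
      (1 + Real.log ((eLpNorm (fun x ↦ (E i).starProjection (∇ f x)) 2
        (stdGaussian (EuclideanSpace ℝ (Fin n)))).toReal /
          (eLpNorm (fun x ↦ (E i).starProjection (∇ f x)) 1
            (stdGaussian (EuclideanSpace ℝ (Fin n)))).toReal)) with hT
    have hT0 : ∀ i, 0 ≤ T i := fun i ↦ by
      have := log_eLpNorm_div_eLpNorm_nonneg (μ := stdGaussian (EuclideanSpace ℝ (Fin n)))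
        ((E i).starProjection.continuous.comp hgr).aestronglyMeasurable (hfin i)
      exact div_nonneg (sq_nonneg _) (add_nonneg zero_le_one this)
    have hterm : ∀ i, talagrandTerm (stdGaussian (EuclideanSpace ℝ (Fin n)))
        (fun x => (E i).starProjection (gradient f x)) = ENNReal.ofReal (T i) := fun i ↦ by
      rw [talagrandTerm, if_neg (hfin i)]
    simp_rw [hterm, ← ENNReal.ofReal_mul (hc _).le]
    rw [← ENNReal.ofReal_sum_of_nonneg fun i _ ↦ mul_nonneg (hc i).le (hT0 i),
      show (4 : ℝ≥0∞) = ENNReal.ofReal 4 by simp, ← ENNReal.ofReal_mul (by norm_num),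
      Finset.mul_sum]
    refine ENNReal.ofReal_le_ofReal (Finset.sum_le_sum fun i _ ↦ ?_)
    have he : Real.exp 1 ≤ 4 := by linarith [Real.exp_one_lt_d9]
    rw [mul_left_comm]
    exact mul_le_mul_of_nonneg_right he (mul_nonneg (hc i).le (hT0 i))
  · -- an infinite term makes the right-hand side infinite, as its coefficient is positive
    push Not at hfin
    obtain ⟨i, hi⟩ := hfin
    have h : ∑ i, ENNReal.ofReal (c i) * talagrandTerm (stdGaussian (EuclideanSpace ℝ (Fin n)))
        (fun x => (E i).starProjection (gradient f x)) = ⊤ := by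
      refine ENNReal.sum_eq_top.2 ⟨i, Finset.mem_univ i, ?_⟩
      rw [talagrandTerm, if_pos hi]
      exact ENNReal.mul_top (by simpa using hc i)
    rw [h, ENNReal.mul_top (by norm_num)]
    exact le_top
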